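/- Theorem 4. For each $n$ consider the linear model $Y_i=\mathbf x_i'\beta_0+\varepsilon_i$, $1\le i\le n$, with fixed covariates $\mathbf x_i=(\mathbf w_i',\mathbf z_i')'\in\mathbb R^{k_n+m_n}$ and $\beta_0=(\beta_{10}',\mathbf 0')'$ (all depending on $n$), where $k_n\ge 1$ and the entries $\beta_{1k}$ of $\beta_{10}\in\mathbb R^{k_n}$ are all nonzero. For all large $n$ the covariates satisfy $\sum_i x_{ij}=0$ and $n^{-1}\sum_i x_{ij}^2=1$ for every $j$. Let $K_n=\{1,\dots,k_n\}$, $J_n=\{k_n+1,\dots,k_n+m_n\}$, $\Sigma_{1n}=n^{-1}\sum_{i}\mathbf w_i\mathbf w_i'$ with smallest eigenvalue $\tau_{1n}$, and $\xi_{nj}=n^{-1}\sum_{i}(\mathbf w_i'\beta_{10})x_{ij}$. Let $0<\gamma<1$, and let $\lambda_n,\lambda_n^*\ge 0$ be penalty parameters. Assume: (B1) $\varepsilon_1,\varepsilon_2,\dots$ are i.i.d. with mean $0$ and variance $\sigma^2\in(0,\infty)$, and there are constants $C,K>0$ with $P(|\varepsilon_i|>x)\le K\exp(-Cx^2)$ for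 all $i$ and $x>0$. (B2) There are constants $c_0,\xi_0>0$ such that, for all large $n$, $|n^{-1/2}\sum_i x_{ij}x_{ik}|\le c_0$ for all $j\in J_n$, $k\in K_n$, and $|\xi_{nk}|>\xi_0$ for all $k\in K_n$. (B3) $\lambda_n/n\to0$, $\lambda_nn^{-\gamma/2}k_n^{\gamma-2}\to\infty$, and $\log m_n=o\big((\lambda_nn^{-\gamma/2})^{2/(2-\gamma)}\big)$ (no condition if $m_n=0$). (B4) There is a constant $b_1<\infty$ with $\max_{k\in K_n}|\beta_{1k}|\le b_1$ for all large $n$. Moreover, there is a constant $b_0>0$ such that $\min_{k\in K_n}|\beta_{1k}|\ge b_0$ for all large $n$ with $\lambda_n^*\neq0$. (B5) There is a constant $\tau_1>0$ with $\tau_{1n}\ge\tau_1$ for all large $n$, and $n^{-1/2}\max_{1\le i\le n}\mathbf w_i'\mathbf w_i\to0$. (B6) $k_n(1+\lambda_n^*)/n\to0$ and $\lambda_n^*(k_n/n)^{1/2}\to0$. Let $\tilde\beta_n$ be a marginal bridge estimator, that is, a global minimizer of $\sum_{j}\sum_{i}(Y_i-x_{ij}\beta_j)^2+\lambda_n\sum_{j}|\beta_j|^\gamma$,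 and let $\hat\beta_n^*$ be a second-stage estimator: it minimizes $\sum_{i}(Y_i-\mathbf x_i'\beta)^2+\lambda_n^*\sum_j|\beta_j|^\gamma$ over all $\beta$ with $\beta_j=0$ whenever $\tilde\beta_{nj}=0$ (ordinary least squares on the selected covariates if $\lambda_n^*=0$). Let $\hat\beta^*_{1n}$ be the vector of the first $k_n$ coordinates of $\hat\beta^*_n$. For $\alpha\in\mathbb R^{k_n}$ let $s_n(\alpha)^2=\sigma^2\alpha'\Sigma_{1n}^{-1}\alpha$. Then $$n^{1/2}s_n(\alpha)^{-1}\alpha'(\hat\beta^*_{1n}-\beta_{10})=n^{-1/2}s_n(\alpha)^{-1}\sum_{i=1}^n\varepsilon_i\,\alpha'\Sigma_{1n}^{-1}\mathbf w_i+R_n(\alpha),$$ where $R_n(\alpha)\to0$ in probability uniformly over $0<\|\alpha\|_2\le1$; and for every sequence $\alpha_n\in\mathbb R^{k_n}$ with $0<\|\alpha_n\|_2\le1$ for all large $n$, $n^{1/2}s_n(\alpha_n)^{-1}\alpha_n'(\hat\beta^*_{1n}-\beta_{10})$ converges in distribution to $N(0,1)$. The same conclusions hold when $\hat\beta_{1n}^*$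 is instead a global minimizer over $\beta_1\in\mathbb R^{k_n}$ of $\sum_i(Y_i-\mathbf w_i'\beta_1)^2+\lambda_n^*\sum_{j\le k_n}|\beta_{1j}|^\gamma$. -/

import Mathlib

open MeasureTheory ProbabilityTheory Filter Topology Asymptotics
open scoped Matrix

/-- The deterministic part of a triangular array of sparse linear regression models.
At sample size `n` there are `k n` covariates with nonzero coefficients (left summand of the index
type) and `m n` covariates with zero coefficients (right summand). -/
structure SparseArray where
  /-- number of nonzero coefficients -/
  k : ℕ → ℕ
  /-- number of zero coefficients -/
  m : ℕ → ℕ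
  /-- design matrix; its `i`-th row is `x_i' = (w_i', z_i')` -/
  X : ∀ n, Matrix (Fin n) (Fin (k n) ⊕ Fin (m n)) ℝ
  /-- the vector of nonzero coefficients -/
  β₁ : ∀ n, Fin (k n) → ℝ

namespace SparseArray

variable (D : SparseArray)

/-- The full true coefficient vector `β₀ = (β₁₀', 0')'`. -/
def β₀ (n : ℕ) : Fin (D.k n) ⊕ Fin (D.m n) → ℝ := Sum.elim (D.β₁ n) 0

/-- The matrix with rows `w_i'`: the covariates with nonzero coefficients. -/
def W (n : ℕ) : Matrix (Fin n) (Fin (D.k n)) ℝ := (D.X n).toCols₁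

/-- `Σ₁ₙ = n⁻¹ W' W`. -/
noncomputable def gram (n : ℕ) : Matrix (Fin (D.k n)) (Fin (D.k n)) ℝ :=
  (n : ℝ)⁻¹ • ((D.W n)ᵀ * D.W n)

theorem gram_isHermitian (n : ℕ) : (D.gram n).IsHermitian := by
  unfold gram Matrix.IsHermitian
  rw [Matrix.conjTranspose_eq_transpose_of_trivial, Matrix.transpose_smul,
    Matrix.transpose_mul, Matrix.transpose_transpose]

/-- `ξₙⱼ = n⁻¹ ∑ᵢ (w_i' β₁₀) x_ij`. -/
noncomputable def xi (n : ℕ) (j : Fin (D.k n) ⊕ Fin (D.m n)) : ℝ :=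
  (n : ℝ)⁻¹ * ∑ i, (D.W n *ᵥ D.β₁ n) i * D.X n i j

/-- The responses `Y_i = x_i' β₀ + ε_i`, `i = 1, …, n`, with error sequence `e`. -/
def response (n : ℕ) (e : ℕ → ℝ) (i : Fin n) : ℝ := (D.X n *ᵥ D.β₀ n) i + e i

/-- Standing conventions, for all large `n`: there is at least one nonzero coefficient, the
coefficients counted by `k n` are nonzero, and the covariates are centered and standardized. -/
def Standing : Prop :=
  ∀ᶠ n in atTop, 0 < D.k n ∧ (∀ j, D.β₁ n j ≠ 0) ∧
    (∀ j, ∑ i, D.X n i j = 0) ∧ (∀ j, (n : ℝ)⁻¹ * ∑ i, (D.X n i j) ^ 2 = 1)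

/-- Partial orthogonality, and marginal covariances bounded away from zero. -/
def CondB2 : Prop :=
  (∃ c₀ > 0, ∀ᶠ n : ℕ in atTop, ∀ (j : Fin (D.m n)) (l : Fin (D.k n)),
      |(√(n : ℝ))⁻¹ * ∑ i, D.X n i (Sum.inr j) * D.X n i (Sum.inl l)| ≤ c₀) ∧
  (∃ ξ₀ > 0, ∀ᶠ n : ℕ in atTop, ∀ l : Fin (D.k n), ξ₀ < |D.xi n (Sum.inl l)|)

/-- Growth conditions on the first-stage penalty, on `k n` and on `m n`. -/
def CondB3 (γ : ℝ) (lam : ℕ → ℝ) : Prop :=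
  Tendsto (fun n : ℕ => lam n / n) atTop (𝓝 0) ∧
  Tendsto (fun n : ℕ => lam n * (n : ℝ) ^ (-γ / 2) * (D.k n : ℝ) ^ (γ - 2)) atTop atTop ∧
  (fun n : ℕ => Real.log (D.m n)) =o[atTop]
    (fun n : ℕ => (lam n * (n : ℝ) ^ (-γ / 2)) ^ (2 / (2 - γ)))

/-- Nonzero coefficients uniformly bounded above in absolute value. -/
def CondB4 : Prop := ∃ b₁ > 0, ∀ᶠ n in atTop, ∀ l, |D.β₁ n l| ≤ b₁

/-- Nonzero coefficients uniformly bounded away from zero, required only at those `n` at which the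
second-stage penalty is present (so nothing is required of ordinary least squares). -/
def LowerBound (lamStar : ℕ → ℝ) : Prop :=
  ∃ b₀ > 0, ∀ᶠ n in atTop, lamStar n ≠ 0 → ∀ l, b₀ ≤ |D.β₁ n l|

/-- The eigenvalues of `Σ₁ₙ` are bounded below, and `n^{-1/2} maxᵢ w_i' w_i → 0`. -/
def CondB5 : Prop :=
  (∃ τ₁ > 0, ∀ᶠ n in atTop, ∀ l, τ₁ ≤ (D.gram_isHermitian n).eigenvalues l) ∧
  Tendsto (fun n : ℕ => (√(n : ℝ))⁻¹ * ⨆ i : Fin n, D.W n i ⬝ᵥ D.W n i) atTop (𝓝 0)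

/-- Growth conditions on the second-stage penalty. -/
def CondB6 (lamStar : ℕ → ℝ) : Prop :=
  Tendsto (fun n : ℕ => (D.k n : ℝ) * (1 + lamStar n) / n) atTop (𝓝 0) ∧
  Tendsto (fun n : ℕ => lamStar n * √((D.k n : ℝ) / n)) atTop (𝓝 0)

/-- `sₙ = (σ² α' Σ₁ₙ⁻¹ α)^{1/2}`. -/
noncomputable def s (σ : ℝ) (n : ℕ) (α : Fin (D.k n) → ℝ) : ℝ :=
  √(σ ^ 2 * (α ⬝ᵥ (D.gram n)⁻¹ *ᵥ α))

/-- `n^{1/2} sₙ⁻¹ α'(b - β₁₀)`. -/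
noncomputable def stat (σ : ℝ) (n : ℕ) (α b : Fin (D.k n) → ℝ) : ℝ :=
  √(n : ℝ) * (D.s σ n α)⁻¹ * (α ⬝ᵥ (b - D.β₁ n))

/-- `n^{-1/2} sₙ⁻¹ ∑ᵢ εᵢ α' Σ₁ₙ⁻¹ w_i`. -/
noncomputable def leading (σ : ℝ) (n : ℕ) (α : Fin (D.k n) → ℝ) (e : ℕ → ℝ) : ℝ :=
  (√(n : ℝ))⁻¹ * (D.s σ n α)⁻¹ * ∑ i : Fin n, e i * (α ⬝ᵥ (D.gram n)⁻¹ *ᵥ D.W n i)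

/-- The asymptotic linear expansion of an estimator of `β₁₀`, with remainder tending to zero in
probability uniformly in `α`, together with asymptotic normality along every sequence `αₙ`
(nonzero, so that `sₙ > 0`, and of Euclidean norm at most one). -/
def OracleNormal {Ω : Type*} [MeasurableSpace Ω] (μ : Measure Ω) [IsProbabilityMeasure μ] (σ : ℝ)
    (ε : ℕ → Ω → ℝ) (est : ∀ n, Ω → Fin (D.k n) → ℝ) : Prop :=
  (∀ δ > 0, Tendsto (fun n => μ {ω | ∃ α : Fin (D.k n) → ℝ, α ≠ 0 ∧ ‖WithLp.toLp 2 α‖ ≤ 1 ∧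
      δ < |D.stat σ n α (est n ω) - D.leading σ n α (fun i => ε i ω)|}) atTop (𝓝 0)) ∧
  (∀ α : ∀ n, Fin (D.k n) → ℝ,
    (∀ᶠ n in atTop, α n ≠ 0 ∧ ‖WithLp.toLp 2 (α n)‖ ≤ 1) →
    TendstoInDistribution (fun n ω => D.stat σ n (α n) (est n ω)) atTop id
      (fun _ => μ) (gaussianReal 0 1))

end SparseArray

/-- Independent identically distributed errors with mean zero, variance `σ² ∈ (0, ∞)` and
sub-Gaussian tails. -/
def CondB1 {Ω : Type*} [MeasurableSpace Ω] (μ : Measure Ω) (σ : ℝ) (ε : ℕ → Ω → ℝ) : Prop :=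
  iIndepFun ε μ ∧ (∀ i, IdentDistrib (ε i) (ε 0) μ μ) ∧ MemLp (ε 0) 2 μ ∧
  ∫ ω, ε 0 ω ∂μ = 0 ∧ variance (ε 0) μ = σ ^ 2 ∧ 0 < σ ∧
  (∃ K > 0, ∃ C > 0, ∀ i, ∀ x > 0, μ.real {ω | x < |ε i ω|} ≤ K * Real.exp (-C * x ^ 2))

/-- The bridge objective `∑ᵢ (y_i - x_i' b)² + λ ∑ⱼ |b_j|^γ`. -/
noncomputable def bridgeObjective {n : ℕ} {ι : Type*} [Fintype ι] (X : Matrix (Fin n) ι ℝ)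
    (y : Fin n → ℝ) (γ lam : ℝ) (b : ι → ℝ) : ℝ :=
  ∑ i, (y i - (X *ᵥ b) i) ^ 2 + lam * ∑ j, |b j| ^ γ

/-- The marginal bridge objective `∑ⱼ ∑ᵢ (y_i - x_ij b_j)² + λ ∑ⱼ |b_j|^γ`. -/
noncomputable def marginalBridgeObjective {n : ℕ} {ι : Type*} [Fintype ι]
    (X : Matrix (Fin n) ι ℝ) (y : Fin n → ℝ) (γ lam : ℝ) (b : ι → ℝ) : ℝ :=
  ∑ j, ∑ i, (y i - X i j * b j) ^ 2 + lam * ∑ j, |b j| ^ γ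

/-- `b` is a marginal bridge estimate: a global minimizer of the marginal bridge objective. -/
def IsMarginalBridge {n : ℕ} {ι : Type*} [Fintype ι] (X : Matrix (Fin n) ι ℝ) (y : Fin n → ℝ)
    (γ lam : ℝ) (b : ι → ℝ) : Prop :=
  ∀ b', marginalBridgeObjective X y γ lam b ≤ marginalBridgeObjective X y γ lam b'

/-- `b` is a bridge estimate fitted on the covariates in `S`: it vanishes off `S` and minimizes the
bridge objective globally among all vectors that vanish off `S`. -/
def IsBridgeOn {n : ℕ} {ι : Type*} [Fintype ι] (X : Matrix (Fin n) ι ℝ) (y : Fin n → ℝ)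
    (γ lam : ℝ) (S : Set ι) (b : ι → ℝ) : Prop :=
  (∀ j ∉ S, b j = 0) ∧
  ∀ b' : ι → ℝ, (∀ j ∉ S, b' j = 0) → bridgeObjective X y γ lam b ≤ bridgeObjective X y γ lam b'

/-! Selection. The marginal objective separates into scalar problems `n x² - 2 x s + λ |x|^γ`, with
score `s = n ξⱼ + ∑ᵢ xᵢⱼ εᵢ`. Up to a constant factor, the minimizer is nonzero exactly when `|s|`
exceeds `n (λ/n)^(1/(2-γ)) = √n · threshold`. Relevant scores have size at least `n ξ₀` up to noise,
while the cutoff is `o(n)`. Irrelevant scores have mean `O(√n k)`, which is negligible against the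
cutoff, and sub-Gaussian noise, which a union bound controls because `log m = o(threshold²)`. Hence
the relevant set is selected with probability tending to one (`tendsto_measure_selection_ne`), and
both claims reduce to an estimator that is, up to vanishing probability, the bridge fit on the
relevant covariates (`oracleNormal_of_tendsto_measure_not_isBridgeOn`).

Expansion. Comparing the objective at the estimate and at the truth gives enough consistency to keep
all coordinates away from zero when a penalty is present. The penalty is then smooth at the
estimate, and the normal equations hold with an extra gradient term. Its contribution is bounded by
Cauchy–Schwarz for the form `Σ₁ₙ⁻¹`: the factor depending on `α` cancels against `sₙ`, leaving a
multiple of `λ* √(k/n)`, uniformly in `α` (`abs_stat_sub_leading_le`).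

Normality. The leading term is a weighted sum of the errors with unit variance and uniformly small
weights, so a characteristic-function argument applies (`tendstoInDistribution_weighted_sum`), and
Slutsky's theorem finishes. -/

/-! ### Sub-Gaussian errors -/

/-- Layer-cake formula: halving the exponent `C` makes the tail at level `t > 1` at most `K t⁻²`,
which is integrable at infinity. -/
theorem integrable_exp_mul_sq_of_tail {Ω : Type*} [MeasurableSpace Ω] {μ : Measure Ω}
    [IsProbabilityMeasure μ] {X : Ω → ℝ} (hX : AEMeasurable X μ) {K C : ℝ} (hC : 0 < C)
    (htail : ∀ x > 0, μ.real {ω | x < |X ω|} ≤ K * Real.exp (-C * x ^ 2)) :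
    Integrable (fun ω => Real.exp (C / 2 * X ω ^ 2)) μ := by
  have hmeas : AEMeasurable (fun ω => Real.exp (C / 2 * X ω ^ 2)) μ := by fun_prop
  refine ⟨hmeas.aestronglyMeasurable, ?_⟩
  rw [hasFiniteIntegral_iff_ofReal (ae_of_all _ fun ω => (Real.exp_pos _).le),
    lintegral_eq_lintegral_meas_lt μ (ae_of_all _ fun ω => (Real.exp_pos _).le) hmeas,
    ← Set.Ioc_union_Ioi_eq_Ioi zero_le_one]
  refine (lintegral_union_le _ _ _).trans_lt (ENNReal.add_lt_top.2 ⟨?_, ?_⟩)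
  · refine (setLIntegral_mono (g := fun _ => 1) measurable_const fun t _ => prob_le_one).trans_lt ?_
    simp
  · have hint : IntegrableOn (fun t : ℝ => K * t ^ (-2 : ℝ)) (Set.Ioi 1) :=
      (integrableOn_Ioi_rpow_of_lt (by norm_num) one_pos).const_mul K
    have hbd : ∀ t ∈ Set.Ioi (1 : ℝ), μ {ω | t < Real.exp (C / 2 * X ω ^ 2)} ≤
        ENNReal.ofReal (K * t ^ (-2 : ℝ)) := by
      intro t ht
      have ht1 : (1 : ℝ) < t := ht
      have hlog : 0 < Real.log t := Real.log_pos ht1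
      have hr : 0 < 2 / C * Real.log t := by positivity
      have hset : {ω | t < Real.exp (C / 2 * X ω ^ 2)} ⊆
          {ω | √(2 / C * Real.log t) < |X ω|} := by
        intro ω hω
        have h1 : Real.log t < C / 2 * X ω ^ 2 :=
          (Real.log_lt_iff_lt_exp (by linarith)).2 hω
        rw [Set.mem_ofPred_eq, ← Real.sqrt_sq_eq_abs]
        refine Real.sqrt_lt_sqrt hr.le ?_
        rw [div_mul_eq_mul_div, div_lt_iff₀ hC]
        linarith
      have := htail _ (Real.sqrt_pos.2 hr)
      rw [Real.sq_sqrt hr.le] at this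
      have he : Real.exp (-C * (2 / C * Real.log t)) = t ^ (-2 : ℝ) := by
        rw [Real.rpow_def_of_pos (by linarith)]
        congr 1
        field_simp
      rw [he] at this
      refine (measure_mono hset).trans ?_
      rw [← ofReal_measureReal]
      exact ENNReal.ofReal_le_ofReal this
    refine (setLIntegral_mono' measurableSet_Ioi hbd).trans_lt ?_
    exact hint.lintegral_lt_top

/-- For a centered variable the linear term integrates to zero, so square-exponential moments
control the moment generating function near zero. -/
theorem Real.exp_le_add_exp_sq (x : ℝ) : Real.exp x ≤ x + Real.exp (x ^ 2) := by
  rcases le_or_gt |x| 1 with h | h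
  · have h1 := (abs_le.1 (Real.abs_exp_sub_one_sub_id_le h)).2
    have h2 := Real.add_one_le_exp (x ^ 2)
    linarith
  · rcases lt_abs.1 h with h | h
    · have : Real.exp x ≤ Real.exp (x ^ 2) := Real.exp_le_exp.2 (by nlinarith)
      linarith
    · have h1 : Real.exp x ≤ 1 := Real.exp_le_one_iff.2 (by linarith)
      have h2 := Real.add_one_le_exp (x ^ 2)
      nlinarith

theorem hasSubgaussianMGF_of_integrable_exp_mul_sq {Ω : Type*} [MeasurableSpace Ω]
    {μ : Measure Ω} [IsProbabilityMeasure μ] {X : Ω → ℝ} (hX : Integrable X μ)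
    (hmean : ∫ ω, X ω ∂μ = 0) {a : ℝ} (ha : 0 < a)
    (hexp : Integrable (fun ω => Real.exp (a * X ω ^ 2)) μ) :
    ∃ c : NNReal, 0 < c ∧ HasSubgaussianMGF X c μ := by
  set M := ∫ ω, Real.exp (a * X ω ^ 2) ∂μ with hM
  have hM1 : 1 ≤ M := by
    have : ∫ _, (1 : ℝ) ∂μ ≤ M := integral_mono (integrable_const _) hexp fun ω =>
      Real.one_le_exp (by positivity)
    simpa using this
  have hint : ∀ t, Integrable (fun ω => Real.exp (t * X ω)) μ := by
    intro t
    refine (hexp.const_mul (Real.exp (t ^ 2 / (4 * a)))).mono'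
      (by have := hX.aemeasurable; exact AEMeasurable.aestronglyMeasurable (by fun_prop))
      (ae_of_all _ fun ω => ?_)
    rw [Real.norm_eq_abs, abs_of_pos (Real.exp_pos _), ← Real.exp_add]
    refine Real.exp_le_exp.2 ?_
    have : t ^ 2 / (4 * a) + a * X ω ^ 2 - t * X ω = a * (X ω - t / (2 * a)) ^ 2 := by
      field_simp
      ring
    nlinarith [mul_nonneg ha.le (sq_nonneg (X ω - t / (2 * a)))]
  -- The proxy adds the costs of two regimes. For `t² ≤ a`, convexity of `exp` on `[0, a X²]` gives
  -- `1 + (t²/a)(M - 1)`. For `t² > a`, Young's inequality gives `exp(t²/(4a)) M`, with `M ≤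
  -- exp((t²/a)(M - 1))`.
  have hc : 0 < 2 * (1 / (4 * a) + (M - 1) / a) := by
    have : 0 ≤ (M - 1) / a := div_nonneg (by linarith) ha.le
    positivity
  refine ⟨(2 * (1 / (4 * a) + (M - 1) / a)).toNNReal, Real.toNNReal_pos.2 hc, hint, fun t => ?_⟩
  have hval : ((2 * (1 / (4 * a) + (M - 1) / a)).toNNReal : ℝ) * t ^ 2 / 2 =
      t ^ 2 / (4 * a) + t ^ 2 / a * (M - 1) := by
    rw [Real.coe_toNNReal _ hc.le]
    field_simp
  rw [hval]
  unfold mgf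
  rcases le_or_gt (t ^ 2) a with hta | hta
  · have hr0 : 0 ≤ t ^ 2 / a := by positivity
    have hr1 : t ^ 2 / a ≤ 1 := (div_le_one ha).2 hta
    have hpt : ∀ ω, Real.exp (t * X ω) ≤
        t * X ω + (1 + t ^ 2 / a * (Real.exp (a * X ω ^ 2) - 1)) := by
      intro ω
      have h1 := Real.exp_le_add_exp_sq (t * X ω)
      have h2 := convexOn_exp.2 (Set.mem_univ 0) (Set.mem_univ (a * X ω ^ 2))
        (sub_nonneg.2 hr1) hr0 (by ring)
      simp only [smul_eq_mul, Real.exp_zero, mul_zero, zero_add, mul_one] at h2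
      have h3 : t ^ 2 / a * (a * X ω ^ 2) = (t * X ω) ^ 2 := by field_simp
      rw [h3] at h2
      linarith
    have hi₁ : Integrable (fun ω => t ^ 2 / a * (Real.exp (a * X ω ^ 2) - 1)) μ :=
      (hexp.sub (integrable_const 1)).const_mul _
    have hi₂ : Integrable (fun ω => 1 + t ^ 2 / a * (Real.exp (a * X ω ^ 2) - 1)) μ :=
      (integrable_const 1).add hi₁
    have hle := integral_mono (hint t) ((hX.const_mul t).add hi₂) hpt
    have hv : ∫ ω, (t * X ω + (1 + t ^ 2 / a * (Real.exp (a * X ω ^ 2) - 1))) ∂μ =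
        1 + t ^ 2 / a * (M - 1) := by
      rw [integral_add (hX.const_mul t) hi₂, integral_add (integrable_const 1) hi₁,
        integral_const_mul, integral_const_mul, hmean, integral_sub hexp (integrable_const 1)]
      simp [hM]
    refine (hle.trans_eq hv).trans ?_
    have h4 := Real.add_one_le_exp (t ^ 2 / (4 * a) + t ^ 2 / a * (M - 1))
    have : 0 ≤ t ^ 2 / (4 * a) := by positivity
    linarith
  · have hpt : ∀ ω, Real.exp (t * X ω) ≤ Real.exp (t ^ 2 / (4 * a)) * Real.exp (a * X ω ^ 2) := by
      intro ω
      rw [← Real.exp_add]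
      refine Real.exp_le_exp.2 ?_
      have : t ^ 2 / (4 * a) + a * X ω ^ 2 - t * X ω = a * (X ω - t / (2 * a)) ^ 2 := by
        field_simp
        ring
      nlinarith [mul_nonneg ha.le (sq_nonneg (X ω - t / (2 * a)))]
    refine (integral_mono (hint t) (hexp.const_mul _) hpt).trans ?_
    rw [integral_const_mul, Real.exp_add]
    refine mul_le_mul_of_nonneg_left ?_ (Real.exp_pos _).le
    have h4 := Real.add_one_le_exp (t ^ 2 / a * (M - 1))
    have : 1 ≤ t ^ 2 / a := (one_le_div ha).2 hta.le
    nlinarith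

/-- Two-sided tail bound for weighted sums of independent sub-Gaussian variables. -/
theorem measureReal_abs_sum_mul_ge_le {Ω : Type*} [MeasurableSpace Ω] {μ : Measure Ω}
    [IsProbabilityMeasure μ] {ε : ℕ → Ω → ℝ} (hind : iIndepFun ε μ) {c : NNReal}
    (hsub : ∀ i, HasSubgaussianMGF (ε i) c μ) {n : ℕ} (u : Fin n → ℝ) {t : ℝ} (ht : 0 ≤ t) :
    μ.real {ω | t ≤ |∑ i, u i * ε i ω|} ≤
      2 * Real.exp (-t ^ 2 / (2 * (c * ∑ i, u i ^ 2))) := by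
  have key : ∀ v : Fin n → ℝ, μ.real {ω | t ≤ ∑ i, v i * ε i ω} ≤
      Real.exp (-t ^ 2 / (2 * (c * ∑ i, v i ^ 2))) := by
    intro v
    have hi : iIndepFun (fun (i : Fin n) ω => v i * ε i ω) μ :=
      (hind.precomp Fin.val_injective).comp (fun i x => v i * x) (fun i => by fun_prop)
    have h := HasSubgaussianMGF.measure_sum_ge_le_of_iIndepFun hi (s := Finset.univ)
      (fun i _ => (hsub i).const_mul (v i)) ht
    refine h.trans_eq ?_
    congr 2
    rw [Finset.mul_sum]
    push_cast
    congr 1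
    refine Finset.sum_congr rfl fun i _ => ?_
    rw [mul_comm]
    rfl
  have hsplit : {ω | t ≤ |∑ i, u i * ε i ω|} ⊆
      {ω | t ≤ ∑ i, u i * ε i ω} ∪ {ω | t ≤ ∑ i, (-u i) * ε i ω} := by
    intro ω hω
    rcases le_abs.1 (show t ≤ |∑ i, u i * ε i ω| from hω) with h | h
    · exact Or.inl h
    · refine Or.inr ?_
      simpa using h
  refine (measureReal_mono hsplit).trans ((measureReal_union_le _ _).trans ?_)
  have h1 := key u
  have h2 := key (fun i => -u i)
  simp only [neg_sq] at h2
  linarith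

/-! ### Central limit theorem for weighted sums -/

/-- Exchange the factors one at a time: each swap costs a single difference, since the remaining
factors lie in the unit disc. -/
theorem norm_prod_sub_prod_le_sum {ι : Type*} (s : Finset ι) (f g : ι → ℂ)
    (hf : ∀ i ∈ s, ‖f i‖ ≤ 1) (hg : ∀ i ∈ s, ‖g i‖ ≤ 1) :
    ‖∏ i ∈ s, f i - ∏ i ∈ s, g i‖ ≤ ∑ i ∈ s, ‖f i - g i‖ := by
  classical
  induction s using Finset.induction_on with
  | empty => simp
  | insert a s ha ih =>
    rw [Finset.prod_insert ha, Finset.prod_insert ha, Finset.sum_insert ha]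
    have h1 : f a * ∏ i ∈ s, f i - g a * ∏ i ∈ s, g i =
        (f a - g a) * ∏ i ∈ s, f i + g a * (∏ i ∈ s, f i - ∏ i ∈ s, g i) := by ring
    rw [h1]
    refine (norm_add_le _ _).trans (add_le_add ?_ ?_)
    · rw [norm_mul]
      refine mul_le_of_le_one_right (norm_nonneg _) ?_
      rw [norm_prod]
      exact Finset.prod_le_one (fun _ _ => norm_nonneg _)
        fun i hi => hf i (Finset.mem_insert_of_mem hi)
    · rw [norm_mul]
      exact (mul_le_of_le_one_left (norm_nonneg _) (hg a (Finset.mem_insert_self _ _))).trans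
        (ih (fun i hi => hf i (Finset.mem_insert_of_mem hi))
          fun i hi => hg i (Finset.mem_insert_of_mem hi))

/-- The characteristic function of a centered variable with variance `σ²` agrees with that of the
Gaussian law to second order at the origin. -/
theorem charFun_sub_gaussian_isLittleO {Ω : Type*} [MeasurableSpace Ω] {μ : Measure Ω}
    [IsProbabilityMeasure μ] {X : Ω → ℝ} (hX : AEMeasurable X μ) (hmean : ∫ ω, X ω ∂μ = 0)
    {σ : ℝ} (hσ : 0 < σ) (hvar : variance X μ = σ ^ 2) :
    (fun t : ℝ => charFun (μ.map X) t - Complex.exp (-((σ * t) ^ 2 / 2 : ℝ)))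
      =o[𝓝 0] fun t => t ^ 2 := by
  have hY : AEMeasurable (fun ω => σ⁻¹ * X ω) μ := by fun_prop
  have h0 : μ[fun ω => σ⁻¹ * X ω] = 0 := by rw [integral_const_mul, hmean, mul_zero]
  have h1 : μ[(fun ω => σ⁻¹ * X ω) ^ 2] = 1 := by
    have : ∫ ω, X ω ^ 2 ∂μ = σ ^ 2 := by
      rw [← hvar, variance_of_integral_eq_zero hX hmean]
    simp only [Pi.pow_apply, mul_pow]
    rw [integral_const_mul, this]
    field_simp
  have hT := taylor_charFun_two hY h0 h1
  have hG : (fun t : ℝ => Complex.exp (-(t ^ 2 / 2 : ℝ)) - (1 - (t : ℂ) ^ 2 / 2))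
      -- The same Taylor theorem is applied to the standard normal law, so the two quadratic
      -- expansions cancel on subtraction.
      =o[𝓝 0] fun t : ℝ => t ^ 2 := by
    have hid : HasLaw (id : ℝ → ℝ) (gaussianReal 0 1) (gaussianReal 0 1) := HasLaw.id
    have hT' := taylor_charFun_two (P := gaussianReal 0 1) (X := id) aemeasurable_id
      (by simp) (by
        have := variance_id_gaussianReal (μ := 0) (v := 1)
        rw [variance_of_integral_eq_zero aemeasurable_id (by simp)] at this
        simpa using this)
    refine hT'.congr_left fun t => ?_
    rw [Measure.map_id, charFun_gaussianReal]
    congr 2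
    push_cast
    simp
  have hD := (hT.sub hG)
  have hlin : Tendsto (fun t : ℝ => σ * t) (𝓝 0) (𝓝 0) := by
    have : Continuous fun t : ℝ => σ * t := by fun_prop
    simpa using this.tendsto 0
  have hC := hD.comp_tendsto hlin
  have hC' : (fun t : ℝ => charFun (μ.map X) t - Complex.exp (-((σ * t) ^ 2 / 2 : ℝ)))
      =o[𝓝 0] fun t => (σ * t) ^ 2 := by
    refine hC.congr (fun t => ?_) (fun t => rfl)
    simp only [Function.comp_apply]
    rw [charFun_map_mul_comp hX, ← mul_assoc, inv_mul_cancel₀ hσ.ne', one_mul]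
    ring
  refine hC'.trans_isBigO ?_
  refine IsBigO.of_bound (σ ^ 2) (Eventually.of_forall fun t => ?_)
  rw [mul_pow, norm_mul, Real.norm_of_nonneg (sq_nonneg σ)]

/-- Central limit theorem for weighted sums of i.i.d. variables with uniformly negligible
weights. -/
theorem tendstoInDistribution_weighted_sum {Ω : Type*} [MeasurableSpace Ω] {μ : Measure Ω}
    [IsProbabilityMeasure μ] {ε : ℕ → Ω → ℝ} (hind : iIndepFun ε μ)
    (hident : ∀ i, IdentDistrib (ε i) (ε 0) μ μ) (hmean : ∫ ω, ε 0 ω ∂μ = 0)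
    {σ : ℝ} (hσ : 0 < σ) (hvar : variance (ε 0) μ = σ ^ 2) (u : ∀ n : ℕ, Fin n → ℝ)
    (hsum : ∀ᶠ n in atTop, σ ^ 2 * ∑ i, u n i ^ 2 = 1)
    (hmax : ∀ δ > 0, ∀ᶠ n in atTop, ∀ i, |u n i| ≤ δ) :
    TendstoInDistribution (fun n ω => ∑ i, u n i * ε i ω) atTop id
      (fun _ => μ) (gaussianReal 0 1) where
  forall_aemeasurable n :=
    Finset.aemeasurable_fun_sum _ fun i _ => (hident i).aemeasurable_fst.const_mul _
  aemeasurable_limit := aemeasurable_id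
  tendsto := by
    refine ProbabilityMeasure.tendsto_iff_tendsto_charFun.2 fun t => ?_
    simp only [ProbabilityMeasure.coe_mk, Measure.map_id]
    have hcf : ∀ n, charFun (μ.map fun ω => ∑ i, u n i * ε i ω) t =
        ∏ i, charFun (μ.map (ε 0)) (u n i * t) := by
      intro n
      have hi : iIndepFun (fun (i : Fin n) ω => u n i * ε i ω) μ :=
        (hind.precomp Fin.val_injective).comp (fun i x => u n i * x) (fun i => by fun_prop)
      rw [iIndepFun.charFun_map_fun_sum_eq_prod (X := fun (i : Fin n) ω => u n i * ε i ω)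
        (fun i => (hident i).aemeasurable_fst.const_mul _) hi, Finset.prod_apply]
      refine Finset.prod_congr rfl fun i _ => ?_
      rw [charFun_map_mul_comp (hident i).aemeasurable_fst, (hident i).map_eq]
    simp_rw [hcf]
    have hlim : charFun (gaussianReal 0 1) t = Complex.exp (-(t ^ 2 / 2 : ℝ)) := by
      rw [charFun_gaussianReal]
      congr 1
      push_cast
      simp
    rw [hlim, tendsto_iff_norm_sub_tendsto_zero, Metric.tendsto_atTop']
    intro η hη
    have hlo := charFun_sub_gaussian_isLittleO (hident 0).aemeasurable_fst hmean hσ hvar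
    -- Summed over the weights, this constant yields a total error `η t² / (2 (t² + 1)) < η`.
    have hK : 0 < η * σ ^ 2 / (2 * (t ^ 2 + 1)) := by positivity
    have hb := hlo.def hK
    rw [Metric.eventually_nhds_iff] at hb
    obtain ⟨r, hr, hb⟩ := hb
    have hδ : 0 < r / (2 * (|t| + 1)) := by positivity
    obtain ⟨N, hN⟩ := eventually_atTop.1 (hsum.and (hmax _ hδ))
    refine ⟨N, fun n hn => ?_⟩
    obtain ⟨hs, hm⟩ := hN n hn.le
    rw [Real.dist_eq, sub_zero, abs_norm]
    -- The normalization `σ² ∑ uᵢ² = 1` splits the Gaussian limit into factors matched to the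
    -- weights.
    have hexp : Complex.exp (-(t ^ 2 / 2 : ℝ)) =
        ∏ i, Complex.exp (-((σ * (u n i * t)) ^ 2 / 2 : ℝ)) := by
      rw [← Complex.exp_sum]
      congr 1
      rw [Finset.sum_neg_distrib, ← Complex.ofReal_sum]
      congr 2
      have : ∑ i, (σ * (u n i * t)) ^ 2 / 2 = (σ ^ 2 * ∑ i, u n i ^ 2) * (t ^ 2 / 2) := by
        rw [Finset.mul_sum, Finset.sum_mul]
        exact Finset.sum_congr rfl fun i _ => by ring
      rw [this, hs, one_mul]
    rw [hexp]
    have hpm : IsProbabilityMeasure (μ.map (ε 0)) :=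
      Measure.isProbabilityMeasure_map (hident 0).aemeasurable_fst
    refine (norm_prod_sub_prod_le_sum _ _ _ (fun i _ => norm_charFun_le_one _)
      (fun i _ => ?_)).trans_lt ?_
    · rw [← Complex.ofReal_neg, Complex.norm_exp_ofReal, Real.exp_le_one_iff]
      linarith [sq_nonneg (σ * (u n i * t))]
    · have hterm : ∀ i, ‖charFun (μ.map (ε 0)) (u n i * t) -
          Complex.exp (-((σ * (u n i * t)) ^ 2 / 2 : ℝ))‖ ≤
          η * σ ^ 2 / (2 * (t ^ 2 + 1)) * (u n i * t) ^ 2 := by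
        intro i
        have hd : dist (u n i * t) 0 < r := by
          rw [Real.dist_eq, sub_zero, abs_mul]
          calc |u n i| * |t| ≤ r / (2 * (|t| + 1)) * (|t| + 1) :=
                mul_le_mul (hm i) (by linarith) (abs_nonneg _) hδ.le
            _ = r / 2 := by field_simp
            _ < r := by linarith
        have := hb hd
        rwa [Real.norm_of_nonneg (sq_nonneg _)] at this
      refine (Finset.sum_le_sum fun i _ => hterm i).trans_lt ?_
      have : ∑ i, η * σ ^ 2 / (2 * (t ^ 2 + 1)) * (u n i * t) ^ 2 =
          η * t ^ 2 / (2 * (t ^ 2 + 1)) * (σ ^ 2 * ∑ i, u n i ^ 2) := by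
        rw [Finset.mul_sum, Finset.mul_sum]
        exact Finset.sum_congr rfl fun i _ => by ring
      rw [this, hs, mul_one, div_lt_iff₀ (by positivity)]
      nlinarith [sq_nonneg t, mul_nonneg hη.le (sq_nonneg t)]

/-! ### Quadratic forms -/

/-- Diagonalization: `A - τ` is a unitary conjugate of the diagonal matrix with entries `λᵢ - τ ≥
0`. -/
theorem Matrix.IsHermitian.mul_dotProduct_self_le {ι : Type*} [Fintype ι] [DecidableEq ι]
    {A : Matrix ι ι ℝ} (hA : A.IsHermitian) {τ : ℝ} (h : ∀ i, τ ≤ hA.eigenvalues i)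
    (v : ι → ℝ) : τ * (v ⬝ᵥ v) ≤ v ⬝ᵥ A *ᵥ v := by
  have hps : (A - τ • (1 : Matrix ι ι ℝ)).PosSemidef := by
    have hd : (Matrix.diagonal fun i => hA.eigenvalues i - τ).PosSemidef :=
      Matrix.posSemidef_diagonal_iff.2 fun i => sub_nonneg.2 (h i)
    have := hd.mul_mul_conjTranspose_same (hA.eigenvectorUnitary : Matrix ι ι ℝ)
    convert this using 1
    have hU : (hA.eigenvectorUnitary : Matrix ι ι ℝ) *
        (hA.eigenvectorUnitary : Matrix ι ι ℝ)ᴴ = 1 :=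
      Unitary.coe_mul_star_self hA.eigenvectorUnitary
    have hsplit : (Matrix.diagonal fun i => hA.eigenvalues i - τ) =
        Matrix.diagonal hA.eigenvalues - τ • (1 : Matrix ι ι ℝ) := by
      rw [← Matrix.diagonal_one, ← Matrix.diagonal_smul, Matrix.diagonal_sub]
      simp
    rw [hsplit, Matrix.mul_sub, Matrix.sub_mul, Matrix.mul_smul, Matrix.mul_one,
      Matrix.smul_mul, hU]
    congr 1
    have := hA.spectral_theorem
    rw [Unitary.conjStarAlgAut_apply] at this
    exact this
  have := hps.dotProduct_mulVec_nonneg v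
  rw [star_trivial, Matrix.sub_mulVec, Matrix.smul_mulVec, Matrix.one_mulVec, dotProduct_sub,
    dotProduct_smul, smul_eq_mul] at this
  linarith

theorem Matrix.PosSemidef.dotProduct_mulVec_sq_le {ι : Type*} [Fintype ι]
    {A : Matrix ι ι ℝ} (hA : A.PosSemidef) (u v : ι → ℝ) :
    (u ⬝ᵥ A *ᵥ v) ^ 2 ≤ (u ⬝ᵥ A *ᵥ u) * (v ⬝ᵥ A *ᵥ v) := by
  classical
  have h := LinearMap.BilinForm.apply_sq_le_of_symm (Matrix.toBilin' A)
    (fun x => by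
      rw [Matrix.toBilin'_apply']
      simpa using hA.dotProduct_mulVec_nonneg x)
    ⟨fun x y => by
      simp only [Matrix.toBilin'_apply', RingHom.id_apply]
      rw [Matrix.dotProduct_mulVec, ← Matrix.mulVec_transpose, dotProduct_comm]
      congr 2
      simpa using hA.1.eq⟩ u v
  simpa only [Matrix.toBilin'_apply'] using h

theorem Matrix.posDef_of_mul_dotProduct_self_le {ι : Type*} [Fintype ι] {A : Matrix ι ι ℝ}
    {τ : ℝ} (hA : A.IsHermitian) (hτ : 0 < τ)
    (h : ∀ v, τ * (v ⬝ᵥ v) ≤ v ⬝ᵥ A *ᵥ v) : A.PosDef := by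
  refine Matrix.PosDef.of_dotProduct_mulVec_pos hA fun x hx => ?_
  rw [star_trivial]
  have h0 : 0 < x ⬝ᵥ x := by
    have := Matrix.dotProduct_star_self_pos_iff.2 hx
    simpa using this
  exact (mul_pos hτ h0).trans_le (h x)

/-- Put `w = A⁻¹ v`. Then `τ (w·w) ≤ v·w`, and combining this with `(v·w)² ≤ (v·v)(w·w)` gives the
claim. -/
theorem Matrix.dotProduct_inv_mulVec_le {ι : Type*} [Fintype ι] [DecidableEq ι]
    {A : Matrix ι ι ℝ} {τ : ℝ} (hA : A.PosDef) (hτ : 0 < τ)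
    (h : ∀ v, τ * (v ⬝ᵥ v) ≤ v ⬝ᵥ A *ᵥ v) (v : ι → ℝ) :
    v ⬝ᵥ A⁻¹ *ᵥ v ≤ (v ⬝ᵥ v) / τ := by
  have hdet : IsUnit A.det := (Matrix.isUnit_iff_isUnit_det A).1 hA.isUnit
  set w := A⁻¹ *ᵥ v with hw
  have hAw : A *ᵥ w = v := by
    rw [hw, Matrix.mulVec_mulVec, Matrix.mul_nonsing_inv _ hdet, Matrix.one_mulVec]
  have h1 := h w
  rw [hAw, dotProduct_comm w v] at h1
  have hcs : (v ⬝ᵥ w) ^ 2 ≤ (v ⬝ᵥ v) * (w ⬝ᵥ w) := by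
    have := (Matrix.PosSemidef.one (n := ι) (R := ℝ)).dotProduct_mulVec_sq_le v w
    simpa using this
  have hvv : 0 ≤ v ⬝ᵥ v := by simpa using dotProduct_star_self_nonneg v
  have hww : 0 ≤ w ⬝ᵥ w := by simpa using dotProduct_star_self_nonneg w
  rw [le_div_iff₀ hτ]
  by_contra hcon
  push Not at hcon
  have h2 : 0 ≤ v ⬝ᵥ w := le_trans (by positivity) h1
  have h3 : 0 < v ⬝ᵥ w := by
    rcases h2.lt_or_eq with h | h
    · exact h
    · rw [← h] at hcon
      simp at hcon
      linarith
  have h4 : (v ⬝ᵥ v) * (w ⬝ᵥ w) * τ ≤ (v ⬝ᵥ v) * (v ⬝ᵥ w) := by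
    calc (v ⬝ᵥ v) * (w ⬝ᵥ w) * τ = (v ⬝ᵥ v) * (τ * (w ⬝ᵥ w)) := by ring
      _ ≤ _ := mul_le_mul_of_nonneg_left h1 hvv
  nlinarith

/-! ### Second moments of the scores -/

theorem variance_sum_mul {Ω : Type*} [MeasurableSpace Ω] {μ : Measure Ω}
    [IsProbabilityMeasure μ] {ε : ℕ → Ω → ℝ} (hind : iIndepFun ε μ)
    (hident : ∀ i, IdentDistrib (ε i) (ε 0) μ μ) (hL2 : MemLp (ε 0) 2 μ)
    {n : ℕ} (u : Fin n → ℝ) :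
    variance (fun ω => ∑ i, u i * ε i ω) μ = variance (ε 0) μ * ∑ i, u i ^ 2 := by
  have hmem : ∀ i, MemLp (ε i) 2 μ := fun i => (hident i).memLp_iff.2 hL2
  have hi : iIndepFun (fun (i : Fin n) ω => u i * ε i ω) μ :=
    (hind.precomp Fin.val_injective).comp (fun i x => u i * x) (fun i => by fun_prop)
  have := IndepFun.variance_sum (s := Finset.univ) (X := fun (i : Fin n) ω => u i * ε i ω)
    (fun i _ => (hmem i).const_mul (u i)) (fun i _ j _ hij => hi.indepFun hij)
  have hf : (fun ω => ∑ i, u i * ε i ω) = ∑ i : Fin n, fun ω => u i * ε i ω := by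
    ext ω
    simp
  rw [hf, this, Finset.mul_sum]
  refine Finset.sum_congr rfl fun i _ => ?_
  rw [variance_const_mul, (hident i).variance_eq]
  ring

theorem integral_sum_mul_sq {Ω : Type*} [MeasurableSpace Ω] {μ : Measure Ω}
    [IsProbabilityMeasure μ] {ε : ℕ → Ω → ℝ} (hind : iIndepFun ε μ)
    (hident : ∀ i, IdentDistrib (ε i) (ε 0) μ μ) (hL2 : MemLp (ε 0) 2 μ)
    (hmean : ∫ ω, ε 0 ω ∂μ = 0) {n : ℕ} (u : Fin n → ℝ) :
    Integrable (fun ω => (∑ i, u i * ε i ω) ^ 2) μ ∧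
    ∫ ω, (∑ i, u i * ε i ω) ^ 2 ∂μ = variance (ε 0) μ * ∑ i, u i ^ 2 := by
  have hmem : ∀ i, MemLp (ε i) 2 μ := fun i => (hident i).memLp_iff.2 hL2
  have hL : MemLp (fun ω => ∑ i, u i * ε i ω) 2 μ :=
    memLp_finsetSum _ fun i _ => (hmem i).const_mul (u i)
  refine ⟨hL.integrable_sq, ?_⟩
  rw [← variance_sum_mul hind hident hL2 u, variance_of_integral_eq_zero hL.aemeasurable]
  rw [integral_finsetSum _ fun (i : Fin n) _ =>
    ((hmem i).const_mul (u i)).integrable (by norm_num)]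
  refine Finset.sum_eq_zero fun i _ => ?_
  rw [integral_const_mul, (hident i).integral_eq, hmean, mul_zero]

namespace SparseArray

variable (D : SparseArray)

/-- The total squared correlation of the relevant covariates with the errors. -/
def scoreSq (n : ℕ) (e : ℕ → ℝ) : ℝ := ∑ l, (∑ i, D.W n i l * e i) ^ 2

theorem scoreSq_nonneg (n : ℕ) (e : ℕ → ℝ) : 0 ≤ D.scoreSq n e :=
  Finset.sum_nonneg fun _ _ => sq_nonneg _

variable {D}

/-- Markov's inequality: the mean is `Var(ε₀) k n`, so the probability is at most a multiple of
`k/n`. This serves both stages. -/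
theorem tendsto_measure_scoreSq_ge {Ω : Type*} [MeasurableSpace Ω] {μ : Measure Ω}
    [IsProbabilityMeasure μ] {ε : ℕ → Ω → ℝ} (hind : iIndepFun ε μ)
    (hident : ∀ i, IdentDistrib (ε i) (ε 0) μ μ) (hL2 : MemLp (ε 0) 2 μ)
    (hmean : ∫ ω, ε 0 ω ∂μ = 0)
    (hnorm : ∀ᶠ n : ℕ in atTop, ∀ l, ∑ i, D.W n i l ^ 2 = n)
    (hk : Tendsto (fun n : ℕ => (D.k n : ℝ) / n) atTop (𝓝 0)) {δ : ℝ} (hδ : 0 < δ) :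
    Tendsto (fun n : ℕ => μ {ω | δ * (n : ℝ) ^ 2 ≤ D.scoreSq n fun i => ε i ω}) atTop (𝓝 0) := by
  have hlim : Tendsto (fun n : ℕ => ENNReal.ofReal (variance (ε 0) μ / δ * ((D.k n : ℝ) / n)))
      atTop (𝓝 0) := by
    have := ENNReal.tendsto_ofReal (hk.const_mul (variance (ε 0) μ / δ))
    simpa using this
  refine tendsto_of_tendsto_of_tendsto_of_le_of_le' tendsto_const_nhds hlim
    (Eventually.of_forall fun _ => zero_le) ?_
  filter_upwards [hnorm, eventually_gt_atTop 0] with n hn hn0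
  have hn0' : (0 : ℝ) < n := Nat.cast_pos.2 hn0
  have hI := fun l => integral_sum_mul_sq hind hident hL2 hmean fun i => D.W n i l
  have hint : Integrable (fun ω => D.scoreSq n fun i => ε i ω) μ :=
    integrable_finsetSum _ fun l _ => (hI l).1
  have hval : ∫ ω, D.scoreSq n (fun i => ε i ω) ∂μ = variance (ε 0) μ * (D.k n * n) := by
    unfold scoreSq
    rw [integral_finsetSum _ fun l _ => (hI l).1]
    simp_rw [fun l => (hI l).2, hn]
    simp
    ring
  have hmk := mul_meas_ge_le_integral_of_nonneg
    (ae_of_all μ fun ω => scoreSq_nonneg D n fun i => ε i ω) hint (δ * (n : ℝ) ^ 2)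
  rw [hval] at hmk
  rw [← ofReal_measureReal]
  refine ENNReal.ofReal_le_ofReal ?_
  have hpos : 0 < δ * (n : ℝ) ^ 2 := by positivity
  rw [← le_div_iff₀' hpos] at hmk
  refine hmk.trans_eq ?_
  field_simp

end SparseArray

/-! ### The scalar bridge problem -/

section Threshold

variable {n lam γ s : ℝ}

/-- A nonzero minimizer of the scalar bridge objective forces the score above the threshold. -/
theorem threshold_le_of_bridge_nonpos (hn : 0 < n) (hlam : 0 < lam) (hγ : γ < 1) {b : ℝ}
    (hb : b ≠ 0) (h : n * b ^ 2 - 2 * b * s + lam * |b| ^ γ ≤ 0) :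
    n * (lam / n) ^ (1 / (2 - γ)) ≤ 2 * |s| := by
  set T := (lam / n) ^ (1 / (2 - γ)) with hT
  have hT0 : 0 < T := by positivity
  have hu : 0 < |b| := abs_pos.2 hb
  have hTpow : lam * T ^ (γ - 1) = n * T := by
    have h1 : T ^ (2 - γ) = lam / n := by
      rw [hT, ← Real.rpow_mul (by positivity), one_div, inv_mul_cancel₀ (by linarith),
        Real.rpow_one]
    have h2 : T = T ^ (2 - γ) * T ^ (γ - 1) := by
      rw [← Real.rpow_add hT0]
      norm_num
    have h3 : lam = n * T ^ (2 - γ) := by rw [h1]; field_simp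
    conv_rhs => rw [h2]
    rw [← mul_assoc, ← h3]
  have hbs : b * s ≤ |b| * |s| := by rw [← abs_mul]; exact le_abs_self _
  have hpow : |b| ^ γ = |b| * |b| ^ (γ - 1) := by
    rw [Real.rpow_sub_one hu.ne']
    field_simp
  have hmain : n * |b| + lam * |b| ^ (γ - 1) ≤ 2 * |s| := by
    refine le_of_mul_le_mul_left ?_ hu
    rw [← sq_abs, hpow] at h
    nlinarith
  -- At `|b| = T` the increasing term `n|b|` and the decreasing term `λ|b|^(γ-1)` both equal `n T`,
  -- so on either side of `T` one of them is at least `n T`.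
  rcases le_or_gt T |b| with hTb | hTb
  · have h1 : 0 ≤ lam * |b| ^ (γ - 1) := by positivity
    nlinarith
  · have h1 : T ^ (γ - 1) ≤ |b| ^ (γ - 1) :=
      Real.rpow_le_rpow_of_nonpos hu hTb.le (by linarith)
    have h2 := mul_le_mul_of_nonneg_left h1 hlam.le
    have h3 : 0 ≤ n * |b| := by positivity
    linarith

/-- If zero minimizes the scalar bridge objective, the score is below the threshold. -/
theorem le_threshold_of_bridge_nonneg (hn : 0 < n) (hlam : 0 ≤ lam) (hγ : γ < 1)
    (h : ∀ x, 0 ≤ n * x ^ 2 - 2 * x * s + lam * |x| ^ γ) :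
    |s| ≤ n * (lam / n) ^ (1 / (2 - γ)) := by
  -- Test at the unpenalized minimizer.
  have hx := h (s / n)
  rcases eq_or_ne s 0 with hs | hs
  · rw [hs, abs_zero]
    positivity
  have hv : 0 < |s / n| := abs_pos.2 (div_ne_zero hs hn.ne')
  have h1 : n * (s / n) ^ 2 - 2 * (s / n) * s = -(n * |s / n| ^ 2) := by
    rw [sq_abs]
    field_simp
    ring
  rw [h1] at hx
  have h2 : |s / n| ^ (2 - γ) ≤ lam / n := by
    rw [le_div_iff₀ hn, Real.rpow_sub hv, div_mul_eq_mul_div,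
      div_le_iff₀ (Real.rpow_pos_of_pos hv γ), Real.rpow_two]
    linarith
  have h3 : |s / n| ≤ (lam / n) ^ (1 / (2 - γ)) := by
    have h4 := Real.rpow_le_rpow (by positivity) h2
      (show 0 ≤ 1 / (2 - γ) from div_nonneg zero_le_one (by linarith))
    rwa [← Real.rpow_mul hv.le, mul_one_div_cancel (by linarith), Real.rpow_one] at h4
  calc |s| = n * |s / n| := by rw [abs_div, abs_of_pos hn]; field_simp
    _ ≤ _ := mul_le_mul_of_nonneg_left h3 hn.le

/-- Puts the cutoff on the `√n` scale of the noise, in the form used by the growth conditions; both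
exponents of `n` are `(1-γ)/(2-γ)`. -/
theorem mul_threshold_eq {γ lam n : ℝ} (hn : 0 < n) (hlam : 0 ≤ lam) (hγ : γ < 1) :
    n * (lam / n) ^ (1 / (2 - γ)) = √n * (lam * n ^ (-γ / 2)) ^ (1 / (2 - γ)) := by
  have hg : (2 - γ) ≠ 0 := by linarith
  rw [Real.div_rpow hlam hn.le, Real.mul_rpow hlam (by positivity), ← Real.rpow_mul hn.le,
    Real.sqrt_eq_rpow, mul_div_assoc', mul_comm n, mul_div_assoc, mul_left_comm,
    ← Real.rpow_add hn]
  congr 1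
  nth_rewrite 1 [← Real.rpow_one n]
  rw [← Real.rpow_sub hn]
  congr 1
  field_simp
  ring

end Threshold

/-! ### Selection by marginal bridge -/

/-- Coordinatewise optimality of marginal bridge estimates. -/
theorem IsMarginalBridge.coord_le {n : ℕ} {ι : Type*} [Fintype ι] {X : Matrix (Fin n) ι ℝ}
    {y : Fin n → ℝ} {γ lam : ℝ} {b : ι → ℝ} (h : IsMarginalBridge X y γ lam b) {j : ι}
    (hnorm : ∑ i, X i j ^ 2 = n) (x : ℝ) :
    n * b j ^ 2 - 2 * b j * (∑ i, X i j * y i) + lam * |b j| ^ γ ≤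
      n * x ^ 2 - 2 * x * (∑ i, X i j * y i) + lam * |x| ^ γ := by
  classical
  have hexp : ∀ z : ℝ, ∑ i, (y i - X i j * z) ^ 2 =
      ∑ i, y i ^ 2 + (n * z ^ 2 - 2 * z * (∑ i, X i j * y i)) := by
    intro z
    rw [← hnorm, Finset.mul_sum, Finset.sum_mul, ← Finset.sum_sub_distrib,
      ← Finset.sum_add_distrib]
    exact Finset.sum_congr rfl fun i _ => by ring
  have hu := h (Function.update b j x)
  unfold marginalBridgeObjective at hu
  rw [Finset.mul_sum, Finset.mul_sum, ← Finset.sum_add_distrib, ← Finset.sum_add_distrib,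
    ← Finset.add_sum_erase _ _ (Finset.mem_univ j),
    ← Finset.add_sum_erase _ _ (Finset.mem_univ j)] at hu
  have hrest : ∑ l ∈ Finset.univ.erase j,
      (∑ i, (y i - X i l * Function.update b j x l) ^ 2 + lam * |Function.update b j x l| ^ γ) =
      ∑ l ∈ Finset.univ.erase j, (∑ i, (y i - X i l * b l) ^ 2 + lam * |b l| ^ γ) := by
    refine Finset.sum_congr rfl fun l hl => ?_
    rw [Function.update_of_ne (Finset.ne_of_mem_erase hl)]
  rw [hrest, Function.update_self, hexp, hexp] at hu
  linarith

namespace SparseArray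

variable {D : SparseArray}

theorem mulVec_sumElim_zero (n : ℕ) (v : Fin (D.k n) → ℝ) :
    D.X n *ᵥ Sum.elim v 0 = D.W n *ᵥ v := by
  ext i
  simp [Matrix.mulVec, dotProduct, W, Matrix.toCols₁]

theorem response_eq (n : ℕ) (e : ℕ → ℝ) (i : Fin n) :
    D.response n e i = (D.W n *ᵥ D.β₁ n) i + e i := by
  unfold response β₀
  rw [mulVec_sumElim_zero]

theorem sum_mul_response {n : ℕ} (hn : 0 < n) (e : ℕ → ℝ) (j : Fin (D.k n) ⊕ Fin (D.m n)) :
    ∑ i, D.X n i j * D.response n e i = n * D.xi n j + ∑ i, D.X n i j * e i := by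
  have hn' : (n : ℝ) ≠ 0 := by positivity
  unfold xi
  rw [← mul_assoc, mul_inv_cancel₀ hn', one_mul, ← Finset.sum_add_distrib]
  refine Finset.sum_congr rfl fun i _ => ?_
  rw [response_eq]
  ring

/-- The marginal bridge keeps every relevant covariate when the scores are small. -/
theorem marginalBridge_inl_ne_zero {n : ℕ} (hn : 0 < n) {γ lam ξ₀ : ℝ} {e : ℕ → ℝ}
    {b : Fin (D.k n) ⊕ Fin (D.m n) → ℝ} (hγ0 : 0 < γ) (hγ1 : γ < 1) (hlam : 0 ≤ lam)
    (hb : IsMarginalBridge (D.X n) (D.response n e) γ lam b)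
    (hnorm : ∀ j, ∑ i, D.X n i j ^ 2 = n) (hξ₀ : 0 < ξ₀)
    (hT : (lam / n) ^ (1 / (2 - γ)) ≤ ξ₀ / 2) {l : Fin (D.k n)} (hxi : ξ₀ < |D.xi n (Sum.inl l)|)
    (hscore : D.scoreSq n e < (ξ₀ / 2) ^ 2 * (n : ℝ) ^ 2) : b (Sum.inl l) ≠ 0 := by
  intro h0
  have hn' : (0 : ℝ) < n := Nat.cast_pos.2 hn
  have hle := le_threshold_of_bridge_nonneg (s := ∑ i, D.X n i (Sum.inl l) * D.response n e i)
    hn' hlam hγ1 (fun x => by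
      have := hb.coord_le (hnorm (Sum.inl l)) x
      rw [h0] at this
      simpa [Real.zero_rpow hγ0.ne'] using this)
  rw [sum_mul_response hn] at hle
  -- Of the signal `n ξ₀`, one half absorbs the noise and the other half the cutoff.
  have hS : |∑ i, D.X n i (Sum.inl l) * e i| < ξ₀ / 2 * n := by
    refine abs_lt_of_sq_lt_sq ?_ (by positivity)
    rw [mul_pow]
    refine lt_of_le_of_lt ?_ hscore
    exact Finset.single_le_sum (f := fun l => (∑ i, D.W n i l * e i) ^ 2)
      (fun _ _ => sq_nonneg _) (Finset.mem_univ l)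
  have h1 : n * ξ₀ < |n * D.xi n (Sum.inl l)| := by
    rw [abs_mul, abs_of_pos hn']
    exact mul_lt_mul_of_pos_left hxi hn'
  have h2 := abs_sub_abs_le_abs_sub (n * D.xi n (Sum.inl l))
    (-∑ i, D.X n i (Sum.inl l) * e i)
  rw [abs_neg, sub_neg_eq_add] at h2
  have h3 := mul_le_mul_of_nonneg_left hT hn'.le
  linarith

/-- The marginal bridge drops an irrelevant covariate whose score is below the threshold. -/
theorem marginalBridge_inr_eq_zero {n : ℕ} (hn : 0 < n) {γ lam : ℝ} {e : ℕ → ℝ}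
    {b : Fin (D.k n) ⊕ Fin (D.m n) → ℝ} (hγ0 : 0 < γ) (hγ1 : γ < 1) (hlam : 0 < lam)
    (hb : IsMarginalBridge (D.X n) (D.response n e) γ lam b)
    (hnorm : ∀ j, ∑ i, D.X n i j ^ 2 = n) {j : Fin (D.m n)}
    (hxi : |n * D.xi n (Sum.inr j)| ≤ n * (lam / n) ^ (1 / (2 - γ)) / 4)
    (hscore : |∑ i, D.X n i (Sum.inr j) * e i| < n * (lam / n) ^ (1 / (2 - γ)) / 4) :
    b (Sum.inr j) = 0 := by
  by_contra h0
  have hn' : (0 : ℝ) < n := Nat.cast_pos.2 hn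
  have hle := threshold_le_of_bridge_nonpos
    (s := ∑ i, D.X n i (Sum.inr j) * D.response n e i) hn' hlam hγ1 h0 (by
      have := hb.coord_le (hnorm (Sum.inr j)) 0
      simpa [Real.zero_rpow hγ0.ne'] using this)
  rw [sum_mul_response hn] at hle
  -- Two quarters of the cutoff bound the score strictly by half of it, whereas a nonzero minimizer
  -- needs at least half.
  have := abs_add_le (n * D.xi n (Sum.inr j)) (∑ i, D.X n i (Sum.inr j) * e i)
  linarith

/-- The mean score of an irrelevant covariate is a sum of `k` inner products weighted by `β₁`, each
`O(√n)` by partial orthogonality. -/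
theorem abs_mul_xi_inr_le {n : ℕ} (hn : 0 < n) {b₁ c₀ : ℝ} (hβ : ∀ l, |D.β₁ n l| ≤ b₁)
    {j : Fin (D.m n)}
    (hc : ∀ l, |(√(n : ℝ))⁻¹ * ∑ i, D.X n i (Sum.inr j) * D.X n i (Sum.inl l)| ≤ c₀) :
    |n * D.xi n (Sum.inr j)| ≤ √n * (D.k n * (b₁ * c₀)) := by
  have hn' : (0 : ℝ) < n := Nat.cast_pos.2 hn
  have hsq : 0 < √(n : ℝ) := Real.sqrt_pos.2 hn'
  have hexp : n * D.xi n (Sum.inr j) =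
      ∑ l, √n * (D.β₁ n l * ((√(n : ℝ))⁻¹ * ∑ i, D.X n i (Sum.inr j) * D.X n i (Sum.inl l))) := by
    unfold xi
    rw [← mul_assoc, mul_inv_cancel₀ hn'.ne', one_mul]
    simp_rw [Matrix.mulVec, dotProduct, Finset.sum_mul]
    rw [Finset.sum_comm]
    refine Finset.sum_congr rfl fun l _ => ?_
    rw [mul_left_comm (D.β₁ n l), ← mul_assoc (√(n : ℝ)), mul_inv_cancel₀ hsq.ne', one_mul,
      Finset.mul_sum]
    exact Finset.sum_congr rfl fun i _ => by
      simp only [W, Matrix.toCols₁, Matrix.of_apply]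
      ring
  rw [hexp]
  refine (Finset.abs_sum_le_sum_abs _ _).trans ?_
  refine (Finset.sum_le_sum (g := fun _ => √(n : ℝ) * (b₁ * c₀)) fun l _ => ?_).trans_eq ?_
  · rw [abs_mul, abs_of_pos hsq, abs_mul]
    refine mul_le_mul_of_nonneg_left ?_ hsq.le
    exact mul_le_mul (hβ l) (hc l) (abs_nonneg _) ((abs_nonneg _).trans (hβ l))
  · rw [Finset.sum_const, Finset.card_univ, Fintype.card_fin, nsmul_eq_mul]
    ring

end SparseArray

namespace SparseArray

variable {D : SparseArray} {γ : ℝ} {lam : ℕ → ℝ}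

theorem Standing.eventually_sum_sq (hD : D.Standing) :
    ∀ᶠ n : ℕ in atTop, ∀ j, ∑ i, D.X n i j ^ 2 = n := by
  filter_upwards [hD, eventually_gt_atTop 0] with n hn hn0 j
  have h := hn.2.2.2 j
  have hn' : (n : ℝ) ≠ 0 := by positivity
  rw [inv_mul_eq_iff_eq_mul₀ hn'] at h
  simpa using h

/-- The selection threshold of the marginal bridge on the `√n` scale. -/
noncomputable def threshold (γ : ℝ) (lam : ℕ → ℝ) (n : ℕ) : ℝ :=
  (lam n * (n : ℝ) ^ (-γ / 2)) ^ (1 / (2 - γ))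

theorem threshold_nonneg (hlam : ∀ n, 0 ≤ lam n) (n : ℕ) : 0 ≤ threshold γ lam n := by
  have := hlam n
  unfold threshold
  positivity

/-- Raising the growth condition to the power `1/(2-γ)` turns `k^(γ-2)` into `k⁻¹`. Thus the
threshold outgrows the mean scores of the irrelevant covariates. -/
theorem CondB3.tendsto_threshold_div (h : D.CondB3 γ lam) (hγ1 : γ < 1) (hlam : ∀ n, 0 ≤ lam n) :
    Tendsto (fun n => threshold γ lam n * (D.k n : ℝ)⁻¹) atTop atTop := by
  have hp : 0 < 1 / (2 - γ) := by
    have : 0 < 2 - γ := by linarith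
    positivity
  refine ((tendsto_rpow_atTop hp).comp h.2.1).congr fun n => ?_
  have := hlam n
  rw [Function.comp_apply, Real.mul_rpow (by positivity) (by positivity),
    ← Real.rpow_mul (Nat.cast_nonneg _), threshold, ← Real.rpow_neg_one]
  congr 2
  have : (2 - γ) ≠ 0 := by linarith
  field_simp
  ring

theorem CondB3.tendsto_threshold (h : D.CondB3 γ lam) (hγ1 : γ < 1) (hlam : ∀ n, 0 ≤ lam n)
    (hD : D.Standing) : Tendsto (threshold γ lam) atTop atTop := by
  refine tendsto_atTop_mono' _ ?_ (h.tendsto_threshold_div hγ1 hlam)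
  filter_upwards [hD] with n hn
  refine mul_le_of_le_one_right (threshold_nonneg hlam n) (inv_le_one_of_one_le₀ ?_)
  exact_mod_cast hn.1

theorem CondB3.eventually_pos (h : D.CondB3 γ lam) (hlam : ∀ n, 0 ≤ lam n) :
    ∀ᶠ n in atTop, 0 < lam n := by
  filter_upwards [h.2.1.eventually_gt_atTop 0] with n hn
  refine (hlam n).lt_of_ne fun h0 => ?_
  rw [← h0] at hn
  simp at hn

theorem CondB3.tendsto_div_rpow (h : D.CondB3 γ lam) (hγ1 : γ < 1) :
    Tendsto (fun n : ℕ => (lam n / n) ^ (1 / (2 - γ))) atTop (𝓝 0) := by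
  have hp : 0 < 1 / (2 - γ) := by
    have : 0 < 2 - γ := by linarith
    positivity
  have := h.1.rpow_const (p := 1 / (2 - γ)) (Or.inr hp.le)
  rwa [Real.zero_rpow hp.ne'] at this

theorem CondB3.log_isLittleO (h : D.CondB3 γ lam) (hlam : ∀ n, 0 ≤ lam n) :
    (fun n : ℕ => Real.log (D.m n)) =o[atTop] fun n => threshold γ lam n ^ 2 := by
  refine h.2.2.congr_right fun n => ?_
  have := hlam n
  rw [threshold, ← Real.rpow_natCast, ← Real.rpow_mul (by positivity)]
  congr 1
  push_cast
  ring

variable {Ω : Type*} [MeasurableSpace Ω] {μ : Measure Ω} [IsProbabilityMeasure μ]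
  {ε : ℕ → Ω → ℝ}

/-- The scores of all irrelevant covariates are eventually below the threshold. -/
theorem tendsto_measure_exists_score_ge (hind : iIndepFun ε μ) {c : NNReal} (hc : 0 < c)
    (hsub : ∀ i, HasSubgaussianMGF (ε i) c μ) (hγ1 : γ < 1) (hlam : ∀ n, 0 ≤ lam n)
    (hD : D.Standing) (hB3 : D.CondB3 γ lam) :
    Tendsto (fun n : ℕ => μ {ω | ∃ j : Fin (D.m n), √n * threshold γ lam n / 4 ≤
      |∑ i, D.X n i (Sum.inr j) * ε i ω|}) atTop (𝓝 0) := by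
  have hc' : (0 : ℝ) < c := hc
  have hlim : Tendsto (fun n : ℕ =>
      ENNReal.ofReal (2 * Real.exp (-(threshold γ lam n ^ 2 / (64 * c))))) atTop (𝓝 0) := by
    have h1 : Tendsto (fun n => threshold γ lam n ^ 2 / (64 * c)) atTop atTop :=
      ((tendsto_pow_atTop two_ne_zero).comp (hB3.tendsto_threshold hγ1 hlam hD)).atTop_div_const
        (by positivity)
    have h2 := (Real.tendsto_exp_neg_atTop_nhds_zero.comp h1).const_mul 2
    simpa using ENNReal.tendsto_ofReal h2
  refine tendsto_of_tendsto_of_tendsto_of_le_of_le' tendsto_const_nhds hlim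
    (Eventually.of_forall fun _ => zero_le) ?_
  -- A quarter of the cutoff gives the tail exponent `threshold²/(32c)`; half of it is spent on the
  -- factor `m`.
  have hlog := (hB3.log_isLittleO hlam).def (show (0 : ℝ) < 1 / (64 * c) by positivity)
  filter_upwards [hD.eventually_sum_sq, eventually_gt_atTop 0, hlog] with n hn hn0 hl
  have hn' : (0 : ℝ) < n := Nat.cast_pos.2 hn0
  have hset : {ω | ∃ j : Fin (D.m n), √n * threshold γ lam n / 4 ≤
      |∑ i, D.X n i (Sum.inr j) * ε i ω|} = ⋃ j : Fin (D.m n), {ω | √n * threshold γ lam n / 4 ≤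
      |∑ i, D.X n i (Sum.inr j) * ε i ω|} := by
    ext ω
    simp
  have hτ := threshold_nonneg (γ := γ) hlam n
  rw [hset, ← ofReal_measureReal]
  refine ENNReal.ofReal_le_ofReal ?_
  refine (measureReal_iUnion_fintype_le _).trans ?_
  have hj : ∀ j : Fin (D.m n), μ.real {ω | √n * threshold γ lam n / 4 ≤
      |∑ i, D.X n i (Sum.inr j) * ε i ω|} ≤
      2 * Real.exp (-(threshold γ lam n ^ 2 / (32 * c))) := by
    intro j
    refine (measureReal_abs_sum_mul_ge_le hind hsub (fun i => D.X n i (Sum.inr j))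
      (by positivity)).trans_eq ?_
    rw [hn, div_pow, mul_pow, Real.sq_sqrt hn'.le]
    congr 2
    field_simp
    ring
  refine (Finset.sum_le_sum fun j _ => hj j).trans ?_
  rw [Finset.sum_const, Finset.card_univ, Fintype.card_fin, nsmul_eq_mul]
  have hm : (D.m n : ℝ) ≤ Real.exp (threshold γ lam n ^ 2 / (64 * c)) := by
    -- The case `m = 0` is separate because passing to logarithms needs `m > 0`.
    rcases Nat.eq_zero_or_pos (D.m n) with h0 | h0
    · rw [h0]
      simpa using (Real.exp_pos _).le
    · rw [← Real.log_le_iff_le_exp (by exact_mod_cast h0)]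
      refine (le_abs_self _).trans (hl.trans_eq ?_)
      rw [Real.norm_of_nonneg (sq_nonneg _)]
      ring
  calc (D.m n : ℝ) * (2 * Real.exp (-(threshold γ lam n ^ 2 / (32 * c))))
      ≤ Real.exp (threshold γ lam n ^ 2 / (64 * c)) *
        (2 * Real.exp (-(threshold γ lam n ^ 2 / (32 * c)))) :=
        mul_le_mul_of_nonneg_right hm (by positivity)
    _ = 2 * Real.exp (-(threshold γ lam n ^ 2 / (64 * c))) := by
        rw [mul_left_comm, ← Real.exp_add]
        congr 2
        field_simp
        norm_num

/-- Marginal bridge selects exactly the relevant covariates with probability tending to one. -/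
theorem tendsto_measure_selection_ne (hind : iIndepFun ε μ)
    (hident : ∀ i, IdentDistrib (ε i) (ε 0) μ μ) (hL2 : MemLp (ε 0) 2 μ)
    (hmean : ∫ ω, ε 0 ω ∂μ = 0) {c : NNReal} (hc : 0 < c)
    (hsub : ∀ i, HasSubgaussianMGF (ε i) c μ) (hγ0 : 0 < γ) (hγ1 : γ < 1)
    (hlam : ∀ n, 0 ≤ lam n) (hD : D.Standing) (hB2 : D.CondB2) (hB3 : D.CondB3 γ lam)
    (hB4 : D.CondB4) (hk : Tendsto (fun n : ℕ => (D.k n : ℝ) / n) atTop (𝓝 0))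
    {b : ∀ n, Ω → Fin (D.k n) ⊕ Fin (D.m n) → ℝ}
    (hb : ∀ n ω, IsMarginalBridge (D.X n) (D.response n fun i => ε i ω) γ (lam n) (b n ω)) :
    Tendsto (fun n => μ {ω | {j | b n ω j ≠ 0} ≠ Set.range Sum.inl}) atTop (𝓝 0) := by
  obtain ⟨⟨c₀, hc₀, hcov⟩, ξ₀, hξ₀, hxi⟩ := hB2
  obtain ⟨b₁, hb₁, hβ⟩ := hB4
  have hnoise := tendsto_measure_scoreSq_ge hind hident hL2 hmean (D := D)
    (hD.eventually_sum_sq.mono fun n hn l => hn (Sum.inl l)) hk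
    (show 0 < (ξ₀ / 2) ^ 2 by positivity)
  have hscore := tendsto_measure_exists_score_ge hind hc hsub hγ1 hlam hD hB3
  have hsum := hnoise.add hscore
  rw [add_zero] at hsum
  refine tendsto_of_tendsto_of_tendsto_of_le_of_le' tendsto_const_nhds hsum
    (Eventually.of_forall fun _ => zero_le) ?_
  filter_upwards [hD, hD.eventually_sum_sq, eventually_gt_atTop 0, hcov, hxi, hβ,
    hB3.eventually_pos hlam, (hB3.tendsto_div_rpow hγ1).eventually_le_const (half_pos hξ₀),
    (hB3.tendsto_threshold_div hγ1 hlam).eventually_ge_atTop (4 * (b₁ * c₀))]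
    with n hst hn hn0 hcov hxi hβ hlpos hT hk
  have hn' : (0 : ℝ) < n := Nat.cast_pos.2 hn0
  have hk0 : (0 : ℝ) < D.k n := Nat.cast_pos.2 hst.1
  have hthr : n * (lam n / n) ^ (1 / (2 - γ)) = √n * threshold γ lam n :=
    mul_threshold_eq hn' (hlam n) hγ1
  refine (measure_mono fun ω hω => ?_).trans (measure_union_le _ _)
  by_contra hcon
  rw [Set.mem_union, not_or] at hcon
  obtain ⟨h1, h2⟩ := hcon
  have h1 : D.scoreSq n (fun i => ε i ω) < (ξ₀ / 2) ^ 2 * (n : ℝ) ^ 2 := not_le.1 h1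
  have h2 : ∀ j : Fin (D.m n), |∑ i, D.X n i (Sum.inr j) * ε i ω| <
      √n * threshold γ lam n / 4 := fun j => not_le.1 fun h => h2 ⟨j, h⟩
  refine hω (Set.ext fun j => ?_)
  rcases j with l | j
  · refine iff_of_true ?_ ⟨l, rfl⟩
    exact marginalBridge_inl_ne_zero hn0 hγ0 hγ1 (hlam n) (hb n ω) hn hξ₀ hT (hxi l) h1
  · refine iff_of_false (not_not.2 ?_) (by simp)
    refine marginalBridge_inr_eq_zero hn0 hγ0 hγ1 hlpos (hb n ω) hn ?_ ?_
    · refine (abs_mul_xi_inr_le hn0 hβ (hcov j)).trans ?_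
      rw [hthr, mul_div_assoc]
      refine mul_le_mul_of_nonneg_left ?_ (Real.sqrt_nonneg _)
      rw [← div_eq_mul_inv, le_div_iff₀ hk0] at hk
      linarith
    · rw [hthr]
      exact h2 j

end SparseArray

/-! ### Deterministic bounds for bridge estimates -/

section Bridge

variable {n : ℕ} {ι : Type*} [Fintype ι] {W : Matrix (Fin n) ι ℝ}
  {γ lam : ℝ} {b : ι → ℝ}

/-- Squared estimation error of a bridge estimate under a lower bound on the design. -/
theorem IsBridgeOn.sub_dotProduct_self_le {β : ι → ℝ} {e : Fin n → ℝ}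
    (h : IsBridgeOn W (fun i => (W *ᵥ β) i + e i) γ lam Set.univ b) (hγ : 0 ≤ γ)
    (hlam : 0 ≤ lam) {b₁ : ℝ} (hβ : ∀ l, |β l| ≤ b₁) {κ : ℝ} (hκ : 0 < κ)
    (hq : ∀ v, κ * (v ⬝ᵥ v) ≤ (W *ᵥ v) ⬝ᵥ (W *ᵥ v)) :
    (b - β) ⬝ᵥ (b - β) ≤ 4 / κ ^ 2 * (∑ l, (∑ i, W i l * e i) ^ 2) +
      2 / κ * (lam * (Fintype.card ι * b₁ ^ γ)) := by
  have hobj := h.2 β (by simp)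
  unfold bridgeObjective at hobj
  set d := b - β with hd
  have hb : b = β + d := by rw [hd]; abel
  have h1 : ∑ i, ((W *ᵥ β) i + e i - (W *ᵥ b) i) ^ 2 =
      ∑ i, e i ^ 2 - 2 * ∑ i, e i * (W *ᵥ d) i + (W *ᵥ d) ⬝ᵥ (W *ᵥ d) := by
    rw [hb, Matrix.mulVec_add, Finset.mul_sum, ← Finset.sum_sub_distrib, dotProduct,
      ← Finset.sum_add_distrib]
    refine Finset.sum_congr rfl fun i _ => ?_
    rw [Pi.add_apply]
    ring
  have h2 : ∑ i, ((W *ᵥ β) i + e i - (W *ᵥ β) i) ^ 2 = ∑ i, e i ^ 2 := by simp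
  rw [h1, h2] at hobj
  have h3 : 0 ≤ lam * ∑ j, |b j| ^ γ :=
    mul_nonneg hlam (Finset.sum_nonneg fun _ _ => Real.rpow_nonneg (abs_nonneg _) _)
  have h4 : lam * ∑ j, |β j| ^ γ ≤ lam * (Fintype.card ι * b₁ ^ γ) := by
    refine mul_le_mul_of_nonneg_left ?_ hlam
    refine (Finset.sum_le_sum fun j _ => Real.rpow_le_rpow (abs_nonneg _) (hβ j) hγ).trans_eq ?_
    simp
  have h5 : ∑ i, e i * (W *ᵥ d) i = ∑ l, (∑ i, W i l * e i) * d l := by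
    simp_rw [Matrix.mulVec, dotProduct, Finset.mul_sum, Finset.sum_mul]
    rw [Finset.sum_comm]
    exact Finset.sum_congr rfl fun _ _ => Finset.sum_congr rfl fun _ _ => by ring
  -- Completing the square spends half of the curvature `κ (d·d)`, leaving the other half to bound
  -- the error.
  have h6 : 2 * ∑ l, (∑ i, W i l * e i) * d l ≤
      2 / κ * (∑ l, (∑ i, W i l * e i) ^ 2) + κ / 2 * (d ⬝ᵥ d) := by
    rw [dotProduct, Finset.mul_sum, Finset.mul_sum, Finset.mul_sum, ← Finset.sum_add_distrib]
    refine Finset.sum_le_sum fun l _ => ?_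
    have : 2 / κ * (∑ i, W i l * e i) ^ 2 + κ / 2 * (d l * d l) -
        2 * ((∑ i, W i l * e i) * d l) =
        2 / κ * ((∑ i, W i l * e i) - κ / 2 * d l) ^ 2 := by
      field_simp
      ring
    have h0 : 0 ≤ 2 / κ * ((∑ i, W i l * e i) - κ / 2 * d l) ^ 2 := by positivity
    linarith
  have h7 := hq d
  rw [h5] at hobj
  have h8 : κ / 2 * (d ⬝ᵥ d) ≤ 2 / κ * (∑ l, (∑ i, W i l * e i) ^ 2) +
      lam * (Fintype.card ι * b₁ ^ γ) := by linarith
  have h9 := mul_le_mul_of_nonneg_left h8 (show 0 ≤ 2 / κ by positivity)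
  have h10 : 2 / κ * (κ / 2 * (d ⬝ᵥ d)) = d ⬝ᵥ d := by field_simp
  rw [h10] at h9
  refine h9.trans_eq ?_
  field_simp
  ring

/-- First-order condition for a bridge estimate in a coordinate where the penalty is smooth. -/
theorem IsBridgeOn.two_mul_sum_eq {y : Fin n → ℝ} (h : IsBridgeOn W y γ lam Set.univ b) {l : ι}
    {p : ℝ} (hp : HasDerivAt (fun t : ℝ => lam * |b l + t| ^ γ) p 0) :
    2 * ∑ i, W i l * (y i - (W *ᵥ b) i) = p := by
  classical
  have hobj : ∀ t : ℝ, bridgeObjective W y γ lam (b + Pi.single l t) =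
      ∑ i, (y i - (W *ᵥ b) i - t * W i l) ^ 2 +
        (lam * |b l + t| ^ γ + lam * ∑ j ∈ Finset.univ.erase l, |b j| ^ γ) := by
    intro t
    unfold bridgeObjective
    congr 1
    · refine Finset.sum_congr rfl fun i _ => ?_
      rw [Matrix.mulVec_add, Matrix.mulVec_single, Pi.add_apply]
      simp
      ring
    · rw [← mul_add, ← Finset.add_sum_erase _ _ (Finset.mem_univ l)]
      congr 2
      · simp
      · refine Finset.sum_congr rfl fun j hj => ?_
        rw [Pi.add_apply, Pi.single_eq_of_ne (Finset.ne_of_mem_erase hj), add_zero]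
  -- Only the penalty in coordinate `l` varies with `t`. Leaving its derivative `p` abstract also
  -- covers `λ = 0`, where `b l` may vanish.
  have hmin : IsLocalMin (fun t : ℝ => ∑ i, (y i - (W *ᵥ b) i - t * W i l) ^ 2 +
      (lam * |b l + t| ^ γ + lam * ∑ j ∈ Finset.univ.erase l, |b j| ^ γ)) 0 := by
    refine Eventually.of_forall fun t => ?_
    simp only
    rw [← hobj, ← hobj, Pi.single_zero, add_zero]
    exact h.2 _ (by simp)
  have hderiv : HasDerivAt (fun t : ℝ => ∑ i, (y i - (W *ᵥ b) i - t * W i l) ^ 2 +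
      (lam * |b l + t| ^ γ + lam * ∑ j ∈ Finset.univ.erase l, |b j| ^ γ))
      (∑ i, (-2 * (W i l * (y i - (W *ᵥ b) i))) + p) 0 := by
    refine HasDerivAt.add (HasDerivAt.fun_sum fun i _ => ?_) (hp.add_const _)
    have := (((hasDerivAt_id (0 : ℝ)).mul_const (W i l)).const_sub (y i - (W *ᵥ b) i)).pow 2
    refine this.congr_deriv ?_
    simp
    ring
  have := hmin.hasDerivAt_eq_zero hderiv
  rw [← Finset.mul_sum] at this
  linarith

theorem hasDerivAt_mul_abs_add_rpow {x : ℝ} (hx : x ≠ 0) :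
    HasDerivAt (fun t : ℝ => lam * |x + t| ^ γ)
      (lam * (SignType.sign x * γ * |x| ^ (γ - 1))) 0 := by
  have h1 : HasDerivAt (fun t : ℝ => x + t) 1 0 := (hasDerivAt_id 0).const_add x
  have h2 : HasDerivAt (fun t : ℝ => |x + t|) (SignType.sign x) 0 := by
    have h3 := hasDerivAt_abs (x := x + 0) (by simpa using hx)
    simpa [Function.comp_def] using h3.comp (0 : ℝ) h1
  have h4 := (h2.rpow_const (p := γ) (Or.inl (by simpa using hx))).const_mul lam
  simpa using h4

end Bridge

/-! ### Linear expansion and weights of the leading term -/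

namespace SparseArray

variable {D : SparseArray}

theorem gram_mulVec (n : ℕ) (v : Fin (D.k n) → ℝ) :
    D.gram n *ᵥ v = (n : ℝ)⁻¹ • (D.W n)ᵀ *ᵥ (D.W n *ᵥ v) := by
  rw [gram, Matrix.smul_mulVec, Matrix.mulVec_mulVec]

theorem dotProduct_gram_mulVec (n : ℕ) (v : Fin (D.k n) → ℝ) :
    v ⬝ᵥ D.gram n *ᵥ v = (n : ℝ)⁻¹ * ((D.W n *ᵥ v) ⬝ᵥ (D.W n *ᵥ v)) := by
  rw [gram_mulVec, dotProduct_smul, smul_eq_mul, Matrix.dotProduct_mulVec, Matrix.vecMul_transpose]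

theorem sum_mul_dotProduct_gram_inv (n : ℕ) (α : Fin (D.k n) → ℝ) (e : Fin n → ℝ) :
    ∑ i, e i * (α ⬝ᵥ (D.gram n)⁻¹ *ᵥ D.W n i) = α ⬝ᵥ (D.gram n)⁻¹ *ᵥ ((D.W n)ᵀ *ᵥ e) := by
  simp_rw [Matrix.dotProduct_mulVec]
  rw [Matrix.vecMul_transpose, dotProduct_comm]
  exact Finset.sum_congr rfl fun i _ => by rw [Matrix.mulVec, dotProduct_comm]

section Design

variable {n : ℕ} {τ σ : ℝ}

theorem s_eq (hσ : 0 < σ) (α : Fin (D.k n) → ℝ) :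
    D.s σ n α = σ * √(α ⬝ᵥ (D.gram n)⁻¹ *ᵥ α) := by
  rw [s, Real.sqrt_mul (sq_nonneg σ), Real.sqrt_sq hσ.le]

/-- Bound on the remainder of the asymptotic linear expansion in terms of the penalty gradient. -/
theorem abs_stat_sub_leading_le (hn : 0 < n) (hτ : 0 < τ) (hσ : 0 < σ)
    (hq : ∀ v, τ * (v ⬝ᵥ v) ≤ v ⬝ᵥ D.gram n *ᵥ v) {e : ℕ → ℝ} {b p : Fin (D.k n) → ℝ} {lam : ℝ}
    (hlam : 0 ≤ lam)
    (hfoc : ∀ l, 2 * ∑ i, D.W n i l * (D.response n e i - (D.W n *ᵥ b) i) = lam * p l)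
    {α : Fin (D.k n) → ℝ} (hα : α ≠ 0) :
    |D.stat σ n α b - D.leading σ n α e| ≤ lam * (√(n : ℝ))⁻¹ * (2 * σ)⁻¹ * √((p ⬝ᵥ p) / τ) := by
  have hn' : (0 : ℝ) < n := Nat.cast_pos.2 hn
  have hsn : 0 < √(n : ℝ) := Real.sqrt_pos.2 hn'
  have hpd : (D.gram n).PosDef :=
    Matrix.posDef_of_mul_dotProduct_self_le (D.gram_isHermitian n) hτ hq
  have hdet : IsUnit (D.gram n).det := (Matrix.isUnit_iff_isUnit_det _).1 hpd.isUnit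
  set B := (D.gram n)⁻¹ with hB
  have hαB : 0 < α ⬝ᵥ B *ᵥ α := by simpa using hpd.inv.dotProduct_mulVec_pos hα
  set d := b - D.β₁ n with hd
  -- The normal equations for the estimation error, perturbed by the penalty gradient.
  have hvec : (D.W n)ᵀ *ᵥ (D.W n *ᵥ d) =
      (D.W n)ᵀ *ᵥ (fun i : Fin n => e i) - (lam / 2) • p := by
    ext l
    have h1 := hfoc l
    have h2 : ∑ i, D.W n i l * (D.response n e i - (D.W n *ᵥ b) i) =
        ((D.W n)ᵀ *ᵥ (fun i : Fin n => e i)) l - ((D.W n)ᵀ *ᵥ (D.W n *ᵥ d)) l := by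
      rw [Matrix.mulVec, Matrix.mulVec, dotProduct, dotProduct, ← Finset.sum_sub_distrib]
      refine Finset.sum_congr rfl fun i _ => ?_
      rw [response_eq, hd, Matrix.mulVec_sub, Pi.sub_apply, Matrix.transpose_apply]
      ring
    rw [h2] at h1
    rw [Pi.sub_apply, Pi.smul_apply, smul_eq_mul]
    linarith
  have hBd : B *ᵥ (D.gram n *ᵥ d) = d := by
    rw [Matrix.mulVec_mulVec, hB, Matrix.nonsing_inv_mul _ hdet, Matrix.one_mulVec]
  have hαd : α ⬝ᵥ d = (n : ℝ)⁻¹ * (α ⬝ᵥ B *ᵥ ((D.W n)ᵀ *ᵥ fun i : Fin n => e i)) -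
      (n : ℝ)⁻¹ * (lam / 2) * (α ⬝ᵥ B *ᵥ p) := by
    conv_lhs => rw [← hBd]
    rw [gram_mulVec, hvec, Matrix.mulVec_smul, Matrix.mulVec_sub, Matrix.mulVec_smul,
      dotProduct_smul, dotProduct_sub, dotProduct_smul, smul_eq_mul, smul_eq_mul]
    ring
  have hdiff : D.stat σ n α b - D.leading σ n α e =
      -(lam * (√(n : ℝ))⁻¹ * (2 * σ)⁻¹ * ((√(α ⬝ᵥ B *ᵥ α))⁻¹ * (α ⬝ᵥ B *ᵥ p))) := by
    have hsq : √(n : ℝ) * (n : ℝ)⁻¹ = (√(n : ℝ))⁻¹ := by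
      rw [← div_eq_mul_inv, Real.sqrt_div_self', one_div]
    rw [stat, leading, sum_mul_dotProduct_gram_inv, s_eq hσ, ← hd, hαd, ← hB, ← hsq]
    ring
  rw [hdiff, abs_neg, abs_mul, abs_of_nonneg (by positivity :
    0 ≤ lam * (√(n : ℝ))⁻¹ * (2 * σ)⁻¹)]
  refine mul_le_mul_of_nonneg_left ?_ (by positivity)
  -- Cauchy–Schwarz for the form `B` produces the very factor `√(α'Bα)` that `sₙ` divides out; hence
  -- the uniformity in `α`.
  have hcs := hpd.inv.posSemidef.dotProduct_mulVec_sq_le α p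
  have hpp := Matrix.dotProduct_inv_mulVec_le hpd hτ hq p
  rw [← hB] at hcs hpp
  have h1 : |α ⬝ᵥ B *ᵥ p| ≤ √(α ⬝ᵥ B *ᵥ α) * √((p ⬝ᵥ p) / τ) := by
    rw [← Real.sqrt_mul hαB.le]
    exact Real.abs_le_sqrt (hcs.trans (mul_le_mul_of_nonneg_left hpp hαB.le))
  have h2 : 0 < √(α ⬝ᵥ B *ᵥ α) := Real.sqrt_pos.2 hαB
  rw [abs_mul, abs_inv, abs_of_pos h2, inv_mul_le_iff₀ h2]
  exact h1

/-- The weight of the `i`-th error in the leading term. -/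
noncomputable def weight (D : SparseArray) (σ : ℝ) (n : ℕ) (α : Fin (D.k n) → ℝ) (i : Fin n) : ℝ :=
  (√(n : ℝ))⁻¹ * (D.s σ n α)⁻¹ * (α ⬝ᵥ (D.gram n)⁻¹ *ᵥ D.W n i)

theorem leading_eq_sum_weight (α : Fin (D.k n) → ℝ) (e : ℕ → ℝ) :
    D.leading σ n α e = ∑ i, D.weight σ n α i * e i := by
  rw [leading, Finset.mul_sum]
  exact Finset.sum_congr rfl fun i _ => by rw [weight]; ring

/-- Since `∑ᵢ wᵢ wᵢ' = n Σ₁ₙ`, the squares of `α'Σ₁ₙ⁻¹wᵢ` sum to `n α'Σ₁ₙ⁻¹α`, which `n sₙ²`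
normalizes. -/
theorem sq_mul_sum_weight_sq (hn : 0 < n) (hσ : 0 < σ) (hpd : (D.gram n).PosDef)
    {α : Fin (D.k n) → ℝ} (hα : α ≠ 0) : σ ^ 2 * ∑ i, D.weight σ n α i ^ 2 = 1 := by
  have hn' : (0 : ℝ) < n := Nat.cast_pos.2 hn
  have hdet : IsUnit (D.gram n).det := (Matrix.isUnit_iff_isUnit_det _).1 hpd.isUnit
  have hαB : 0 < α ⬝ᵥ (D.gram n)⁻¹ *ᵥ α := by simpa using hpd.inv.dotProduct_mulVec_pos hα
  have hsymm : α ᵥ* (D.gram n)⁻¹ = (D.gram n)⁻¹ *ᵥ α := by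
    rw [← Matrix.mulVec_transpose]
    congr 1
    simpa using hpd.inv.1.eq
  have hsum : ∑ i, (α ⬝ᵥ (D.gram n)⁻¹ *ᵥ D.W n i) ^ 2 = n * (α ⬝ᵥ (D.gram n)⁻¹ *ᵥ α) := by
    have h1 : ∑ i, (α ⬝ᵥ (D.gram n)⁻¹ *ᵥ D.W n i) ^ 2 =
        (D.W n *ᵥ ((D.gram n)⁻¹ *ᵥ α)) ⬝ᵥ (D.W n *ᵥ ((D.gram n)⁻¹ *ᵥ α)) := by
      refine Finset.sum_congr rfl fun i _ => ?_
      rw [Matrix.dotProduct_mulVec, hsymm, dotProduct_comm, sq]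
      rfl
    have h2 := D.dotProduct_gram_mulVec n ((D.gram n)⁻¹ *ᵥ α)
    rw [Matrix.mulVec_mulVec, Matrix.mul_nonsing_inv _ hdet, Matrix.one_mulVec,
      dotProduct_comm] at h2
    rw [h1, h2]
    field_simp
  simp_rw [weight, mul_pow]
  rw [← Finset.mul_sum, hsum, s_eq hσ, inv_pow, inv_pow, mul_pow, Real.sq_sqrt hn'.le,
    Real.sq_sqrt hαB.le]
  field_simp

theorem weight_sq_le (hn : 0 < n) (hτ : 0 < τ) (hσ : 0 < σ)
    (hq : ∀ v, τ * (v ⬝ᵥ v) ≤ v ⬝ᵥ D.gram n *ᵥ v) {α : Fin (D.k n) → ℝ} (hα : α ≠ 0) (i : Fin n) :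
    D.weight σ n α i ^ 2 ≤ (σ ^ 2 * τ)⁻¹ * ((√(n : ℝ))⁻¹ * ⨆ i : Fin n, D.W n i ⬝ᵥ D.W n i) := by
  have hn' : (0 : ℝ) < n := Nat.cast_pos.2 hn
  have hpd : (D.gram n).PosDef :=
    Matrix.posDef_of_mul_dotProduct_self_le (D.gram_isHermitian n) hτ hq
  have hαB : 0 < α ⬝ᵥ (D.gram n)⁻¹ *ᵥ α := by simpa using hpd.inv.dotProduct_mulVec_pos hα
  have hcs := hpd.inv.posSemidef.dotProduct_mulVec_sq_le α (D.W n i)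
  have hpp := Matrix.dotProduct_inv_mulVec_le hpd hτ hq (D.W n i)
  have hsup : D.W n i ⬝ᵥ D.W n i ≤ ⨆ i : Fin n, D.W n i ⬝ᵥ D.W n i :=
    le_ciSup (f := fun i => D.W n i ⬝ᵥ D.W n i) (Set.finite_range _).bddAbove i
  have hww : 0 ≤ D.W n i ⬝ᵥ D.W n i := by simpa using dotProduct_star_self_nonneg (D.W n i)
  have h1 : (1 : ℝ) ≤ √(n : ℝ) := by
    rw [Real.one_le_sqrt]
    exact_mod_cast hn
  rw [weight, mul_pow, mul_pow, s_eq hσ, inv_pow, inv_pow, mul_pow, Real.sq_sqrt hn'.le,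
    Real.sq_sqrt hαB.le]
  calc (n : ℝ)⁻¹ * (σ ^ 2 * (α ⬝ᵥ (D.gram n)⁻¹ *ᵥ α))⁻¹ * (α ⬝ᵥ (D.gram n)⁻¹ *ᵥ D.W n i) ^ 2
      ≤ (n : ℝ)⁻¹ * (σ ^ 2 * (α ⬝ᵥ (D.gram n)⁻¹ *ᵥ α))⁻¹ *
        ((α ⬝ᵥ (D.gram n)⁻¹ *ᵥ α) * ((D.W n i ⬝ᵥ D.W n i) / τ)) := by
        refine mul_le_mul_of_nonneg_left ?_ (by positivity)
        exact hcs.trans (mul_le_mul_of_nonneg_left hpp hαB.le)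
    _ = (σ ^ 2 * τ)⁻¹ * ((n : ℝ)⁻¹ * (D.W n i ⬝ᵥ D.W n i)) := by field_simp
    -- Weakening `n⁻¹` to `n^(-1/2)` matches the form of `CondB5`.
    _ ≤ (σ ^ 2 * τ)⁻¹ * ((√(n : ℝ))⁻¹ * ⨆ i : Fin n, D.W n i ⬝ᵥ D.W n i) := by
        refine mul_le_mul_of_nonneg_left ?_ (by positivity)
        refine mul_le_mul ?_ hsup hww (by positivity)
        refine inv_anti₀ (by positivity) ?_
        nlinarith [Real.mul_self_sqrt hn'.le]

end Design

end SparseArray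

/-! ### The oracle property -/

namespace SparseArray

variable {D : SparseArray} {γ σ : ℝ} {lamStar : ℕ → ℝ}

/-- Zero coordinates affect neither the fit nor the penalty; `γ ≠ 0` is needed because `0 ^ 0 = 1`.
-/
theorem isBridgeOn_inl {n : ℕ} (hγ : γ ≠ 0) {lam : ℝ} {y : Fin n → ℝ}
    {b : Fin (D.k n) ⊕ Fin (D.m n) → ℝ}
    (h : IsBridgeOn (D.X n) y γ lam (Set.range Sum.inl) b) :
    IsBridgeOn (D.W n) y γ lam Set.univ (fun l => b (Sum.inl l)) := by
  have hobj : ∀ v : Fin (D.k n) → ℝ, bridgeObjective (D.X n) y γ lam (Sum.elim v 0) =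
      bridgeObjective (D.W n) y γ lam v := by
    intro v
    unfold bridgeObjective
    rw [mulVec_sumElim_zero, Fintype.sum_sum_type]
    simp [Real.zero_rpow hγ]
  have hb : b = Sum.elim (fun l => b (Sum.inl l)) 0 := by
    ext j
    rcases j with l | j
    · rfl
    · exact h.1 _ (by simp)
  refine ⟨by simp, fun v _ => ?_⟩
  rw [← hobj, ← hobj, ← hb]
  refine h.2 _ fun j hj => ?_
  rcases j with l | j
  · exact absurd ⟨l, rfl⟩ hj
  · rfl

theorem CondB6.tendsto_k_div (h : D.CondB6 lamStar) (hlamStar : ∀ n, 0 ≤ lamStar n) :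
    Tendsto (fun n : ℕ => (D.k n : ℝ) / n) atTop (𝓝 0) := by
  refine squeeze_zero (fun n => by positivity) (fun n => ?_) h.1
  have := hlamStar n
  gcongr
  nlinarith [(Nat.cast_nonneg (D.k n) : (0 : ℝ) ≤ D.k n)]

theorem CondB6.tendsto_lam_mul_k_div (h : D.CondB6 lamStar) (hlamStar : ∀ n, 0 ≤ lamStar n) :
    Tendsto (fun n : ℕ => lamStar n * D.k n / n) atTop (𝓝 0) := by
  refine squeeze_zero (fun n => ?_) (fun n => ?_) h.1
  · have := hlamStar n
    positivity
  · have := hlamStar n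
    refine div_le_div_of_nonneg_right ?_ (Nat.cast_nonneg n)
    nlinarith [(Nat.cast_nonneg (D.k n) : (0 : ℝ) ≤ D.k n)]

/-- Off the event that the scores are large, the penalty gradient at the estimate is bounded. -/
theorem exists_gradient_of_scoreSq_lt {n : ℕ} (hn : 0 < n) (hγ0 : 0 < γ) (hγ1 : γ < 1) {lam : ℝ}
    (hlam : 0 ≤ lam) {τ b₀ b₁ : ℝ} (hτ : 0 < τ) (hb₀ : 0 < b₀)
    (hq : ∀ v, τ * (v ⬝ᵥ v) ≤ v ⬝ᵥ D.gram n *ᵥ v) (hβ : ∀ l, |D.β₁ n l| ≤ b₁)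
    (hlow : lam ≠ 0 → ∀ l, b₀ ≤ |D.β₁ n l|)
    (hpen : lam * D.k n / n * (2 / τ * b₁ ^ γ) ≤ b₀ ^ 2 / 8) {e : ℕ → ℝ}
    (hscore : D.scoreSq n e < τ ^ 2 * b₀ ^ 2 / 32 * (n : ℝ) ^ 2) {b : Fin (D.k n) → ℝ}
    (hb : IsBridgeOn (D.W n) (D.response n e) γ lam Set.univ b) :
    ∃ p : Fin (D.k n) → ℝ,
      (∀ l, 2 * ∑ i, D.W n i l * (D.response n e i - (D.W n *ᵥ b) i) = lam * p l) ∧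
      p ⬝ᵥ p ≤ D.k n * (γ * (b₀ / 2) ^ (γ - 1)) ^ 2 := by
  have hn' : (0 : ℝ) < n := Nat.cast_pos.2 hn
  -- Without a penalty the gradient is zero everywhere, so no separation from zero is required.
  rcases eq_or_ne lam 0 with h0 | h0
  · refine ⟨0, fun l => ?_, by simpa using by positivity⟩
    rw [Pi.zero_apply, mul_zero]
    refine hb.two_mul_sum_eq ?_
    simp only [h0, zero_mul]
    exact hasDerivAt_const _ _
  have hresp : D.response n e = fun i => (D.W n *ᵥ D.β₁ n) i + e i := funext (response_eq n e)
  have hrate := IsBridgeOn.sub_dotProduct_self_le (κ := n * τ) (hresp ▸ hb) hγ0.le hlam hβ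
    (by positivity) (fun v => by
      have := hq v
      rw [dotProduct_gram_mulVec, ← div_eq_inv_mul, le_div_iff₀ hn'] at this
      linarith)
  -- Noise and penalty each contribute at most `b₀²/8`, the noise strictly less. Each coordinate
  -- then stays at least `b₀/2` from zero, where the penalty is smooth.
  have hd : (b - D.β₁ n) ⬝ᵥ (b - D.β₁ n) < (b₀ / 2) ^ 2 := by
    have h1 : 4 / (n * τ) ^ 2 * D.scoreSq n e <
        4 / (n * τ) ^ 2 * (τ ^ 2 * b₀ ^ 2 / 32 * (n : ℝ) ^ 2) :=
      mul_lt_mul_of_pos_left hscore (by positivity)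
    have h2 : 4 / (n * τ) ^ 2 * (τ ^ 2 * b₀ ^ 2 / 32 * (n : ℝ) ^ 2) = b₀ ^ 2 / 8 := by
      field_simp
      norm_num
    have h3 : 2 / (n * τ) * (lam * (Fintype.card (Fin (D.k n)) * b₁ ^ γ)) =
        lam * D.k n / n * (2 / τ * b₁ ^ γ) := by
      rw [Fintype.card_fin]
      field_simp
    rw [h3] at hrate
    change _ ≤ 4 / (n * τ) ^ 2 * D.scoreSq n e + _ at hrate
    nlinarith
  have hbl : ∀ l, b₀ / 2 ≤ |b l| := by
    intro l
    have h1 : |b l - D.β₁ n l| < b₀ / 2 := by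
      refine abs_lt_of_sq_lt_sq (lt_of_le_of_lt ?_ hd) (by positivity)
      rw [dotProduct]
      simp_rw [← sq]
      exact Finset.single_le_sum (f := fun l => ((b - D.β₁ n) l) ^ 2)
        (fun _ _ => sq_nonneg _) (Finset.mem_univ l)
    have h2 := abs_sub_abs_le_abs_sub (D.β₁ n l) (b l)
    rw [abs_sub_comm] at h2
    have h3 := hlow h0 l
    linarith
  refine ⟨fun l => SignType.sign (b l) * γ * |b l| ^ (γ - 1), fun l => ?_, ?_⟩
  · refine hb.two_mul_sum_eq (hasDerivAt_mul_abs_add_rpow ?_)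
    exact abs_pos.1 ((half_pos hb₀).trans_le (hbl l))
  · rw [dotProduct]
    refine (Finset.sum_le_sum (g := fun _ => (γ * (b₀ / 2) ^ (γ - 1)) ^ 2)
      fun l _ => ?_).trans_eq (by simp)
    rw [← sq, ← sq_abs]
    refine pow_le_pow_left₀ (abs_nonneg _) ?_ 2
    have hsign : |((SignType.sign (b l) : SignType) : ℝ)| ≤ 1 := by
      rcases SignType.sign (b l) <;> simp
    rw [abs_mul, abs_mul, abs_of_pos hγ0, abs_of_nonneg (Real.rpow_nonneg (abs_nonneg _) _)]
    have h1 : |b l| ^ (γ - 1) ≤ (b₀ / 2) ^ (γ - 1) :=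
      Real.rpow_le_rpow_of_nonpos (half_pos hb₀) (hbl l) (by linarith)
    exact mul_le_mul (mul_le_of_le_one_left hγ0.le hsign) h1 (by positivity) hγ0.le

variable {Ω : Type*} [MeasurableSpace Ω] {μ : Measure Ω} [IsProbabilityMeasure μ]
  {ε : ℕ → Ω → ℝ}

/-- The remainder of the linear expansion vanishes in probability, uniformly in the direction, for
an estimator that is an oracle bridge estimate with probability tending to one. -/
theorem tendsto_measure_remainder_gt (hind : iIndepFun ε μ)
    (hident : ∀ i, IdentDistrib (ε i) (ε 0) μ μ) (hL2 : MemLp (ε 0) 2 μ)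
    (hmean : ∫ ω, ε 0 ω ∂μ = 0) (hσ : 0 < σ) (hγ0 : 0 < γ) (hγ1 : γ < 1)
    (hlamStar : ∀ n, 0 ≤ lamStar n) (hD : D.Standing) (hB4 : D.CondB4) (hB5 : D.CondB5)
    (hB6 : D.CondB6 lamStar) (hlow : D.LowerBound lamStar) {est : ∀ n, Ω → Fin (D.k n) → ℝ}
    (hest : Tendsto (fun n => μ {ω | ¬ IsBridgeOn (D.W n) (D.response n fun i => ε i ω) γ
      (lamStar n) Set.univ (est n ω)}) atTop (𝓝 0)) {δ : ℝ} (hδ : 0 < δ) :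
    Tendsto (fun n => μ {ω | ∃ α : Fin (D.k n) → ℝ, α ≠ 0 ∧
      δ < |D.stat σ n α (est n ω) - D.leading σ n α (fun i => ε i ω)|}) atTop (𝓝 0) := by
  obtain ⟨b₀, hb₀, hlow⟩ := hlow
  obtain ⟨b₁, hb₁, hβ⟩ := hB4
  obtain ⟨⟨τ, hτ, heig⟩, -⟩ := hB5
  have hnoise := tendsto_measure_scoreSq_ge hind hident hL2 hmean (D := D)
    (hD.eventually_sum_sq.mono fun n hn l => hn (Sum.inl l)) (hB6.tendsto_k_div hlamStar)
    (show 0 < τ ^ 2 * b₀ ^ 2 / 32 by positivity)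
  have hsum := hest.add hnoise
  rw [add_zero] at hsum
  have hpen : ∀ᶠ n : ℕ in atTop, lamStar n * D.k n / n * (2 / τ * b₁ ^ γ) ≤ b₀ ^ 2 / 8 := by
    have := (hB6.tendsto_lam_mul_k_div hlamStar).mul_const (2 / τ * b₁ ^ γ)
    rw [zero_mul] at this
    exact this.eventually_le_const (by positivity)
  -- The constant left after extracting `λ* √(k/n)` from the remainder bound; the squared norm of
  -- the gradient supplies the factor `k`.
  set M := (2 * σ)⁻¹ * √((γ * (b₀ / 2) ^ (γ - 1)) ^ 2 / τ) with hM
  have hrem : ∀ᶠ n : ℕ in atTop, lamStar n * √((D.k n : ℝ) / n) * M ≤ δ := by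
    have := hB6.2.mul_const M
    rw [zero_mul] at this
    exact this.eventually_le_const hδ
  refine tendsto_of_tendsto_of_tendsto_of_le_of_le' tendsto_const_nhds hsum
    (Eventually.of_forall fun _ => zero_le) ?_
  filter_upwards [eventually_gt_atTop 0, heig, hβ, hlow, hpen, hrem]
    with n hn0 heig hβ hlow hpen hrem
  have hn' : (0 : ℝ) < n := Nat.cast_pos.2 hn0
  have hq := (D.gram_isHermitian n).mul_dotProduct_self_le heig
  refine (measure_mono fun ω hω => ?_).trans (measure_union_le _ _)
  by_contra hcon
  rw [Set.mem_union, not_or] at hcon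
  obtain ⟨h1, h2⟩ := hcon
  have h1 : IsBridgeOn (D.W n) (D.response n fun i => ε i ω) γ (lamStar n) Set.univ (est n ω) :=
    not_not.1 h1
  have h2 : D.scoreSq n (fun i => ε i ω) < τ ^ 2 * b₀ ^ 2 / 32 * (n : ℝ) ^ 2 := not_le.1 h2
  obtain ⟨α, hα, hgt⟩ := hω
  obtain ⟨p, hfoc, hp⟩ := exists_gradient_of_scoreSq_lt hn0 hγ0 hγ1 (hlamStar n) hτ hb₀ hq hβ
    hlow hpen h2 h1
  have hle := abs_stat_sub_leading_le hn0 hτ hσ hq (hlamStar n) hfoc hα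
  refine absurd hgt (not_lt.2 (hle.trans (le_trans ?_ hrem)))
  have hls := hlamStar n
  have hsq : √((p ⬝ᵥ p) / τ) ≤ √(D.k n) * √((γ * (b₀ / 2) ^ (γ - 1)) ^ 2 / τ) := by
    rw [← Real.sqrt_mul (Nat.cast_nonneg _), mul_div_assoc']
    exact Real.sqrt_le_sqrt (by gcongr)
  calc lamStar n * (√(n : ℝ))⁻¹ * (2 * σ)⁻¹ * √((p ⬝ᵥ p) / τ)
      ≤ lamStar n * (√(n : ℝ))⁻¹ * (2 * σ)⁻¹ *
        (√(D.k n) * √((γ * (b₀ / 2) ^ (γ - 1)) ^ 2 / τ)) :=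
        mul_le_mul_of_nonneg_left hsq (by positivity)
    _ = lamStar n * √((D.k n : ℝ) / n) * M := by
        rw [hM, Real.sqrt_div (Nat.cast_nonneg _)]
        ring

/-- Asymptotic normality of the leading term along a sequence of directions. -/
theorem tendstoInDistribution_leading (hind : iIndepFun ε μ)
    (hident : ∀ i, IdentDistrib (ε i) (ε 0) μ μ) (hmean : ∫ ω, ε 0 ω ∂μ = 0) (hσ : 0 < σ)
    (hvar : variance (ε 0) μ = σ ^ 2) (hB5 : D.CondB5) {α : ∀ n, Fin (D.k n) → ℝ}
    (hα : ∀ᶠ n in atTop, α n ≠ 0) :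
    TendstoInDistribution (fun n ω => D.leading σ n (α n) fun i => ε i ω) atTop id
      (fun _ => μ) (gaussianReal 0 1) := by
  obtain ⟨⟨τ, hτ, heig⟩, hmax⟩ := hB5
  simp_rw [leading_eq_sum_weight]
  refine tendstoInDistribution_weighted_sum hind hident hmean hσ hvar
    (fun n => D.weight σ n (α n)) ?_ fun δ hδ => ?_
  · filter_upwards [hα, heig, eventually_gt_atTop 0] with n hα heig hn
    have hq := (D.gram_isHermitian n).mul_dotProduct_self_le heig
    exact sq_mul_sum_weight_sq hn hσ
      (Matrix.posDef_of_mul_dotProduct_self_le (D.gram_isHermitian n) hτ hq) hα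
  · have hlim := hmax.const_mul (σ ^ 2 * τ)⁻¹
    rw [mul_zero] at hlim
    filter_upwards [hα, heig, eventually_gt_atTop 0,
      hlim.eventually_le_const (show 0 < δ ^ 2 by positivity)] with n hα heig hn hle i
    have hq := (D.gram_isHermitian n).mul_dotProduct_self_le heig
    exact abs_le_of_sq_le_sq ((weight_sq_le hn hτ hσ hq hα i).trans hle) hδ.le

/-- The oracle property of an estimator that is an oracle bridge estimate with probability tending
to one. -/
theorem oracleNormal_of_tendsto_measure_not_isBridgeOn (hB1 : CondB1 μ σ ε) (hγ0 : 0 < γ)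
    (hγ1 : γ < 1) (hlamStar : ∀ n, 0 ≤ lamStar n) (hD : D.Standing) (hB4 : D.CondB4)
    (hB5 : D.CondB5) (hB6 : D.CondB6 lamStar) (hlow : D.LowerBound lamStar)
    {est : ∀ n, Ω → Fin (D.k n) → ℝ}
    (hest : Tendsto (fun n => μ {ω | ¬ IsBridgeOn (D.W n) (D.response n fun i => ε i ω) γ
      (lamStar n) Set.univ (est n ω)}) atTop (𝓝 0)) (hmeas : ∀ n, AEMeasurable (est n) μ) :
    D.OracleNormal μ σ ε est := by
  obtain ⟨hind, hident, hL2, hmean, hvar, hσ, -⟩ := hB1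
  have hrem := fun δ (hδ : 0 < δ) => tendsto_measure_remainder_gt hind hident hL2 hmean hσ hγ0 hγ1
    hlamStar hD hB4 hB5 hB6 hlow hest hδ
  refine ⟨fun δ hδ => ?_, fun α hα => ?_⟩
  · refine tendsto_of_tendsto_of_tendsto_of_le_of_le tendsto_const_nhds (hrem δ hδ)
      (fun _ => zero_le) fun n => measure_mono ?_
    rintro ω ⟨α, hα, -, h⟩
    exact ⟨α, hα, h⟩
  · refine tendstoInDistribution_of_tendstoInMeasure_sub _ _
      (tendstoInDistribution_leading hind hident hmean hσ hvar hB5 (hα.mono fun n hn => hn.1))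
      ?_ fun n => ?_
    · rw [tendstoInMeasure_iff_norm]
      intro δ hδ
      -- Halving `δ` passes from the non-strict inequality in convergence in measure to the strict
      -- one in `hrem`.
      refine tendsto_of_tendsto_of_tendsto_of_le_of_le' tendsto_const_nhds
        (hrem (δ / 2) (half_pos hδ)) (Eventually.of_forall fun _ => zero_le) ?_
      filter_upwards [hα] with n hα
      refine measure_mono fun ω hω => ⟨α n, hα.1, ?_⟩
      have hω : δ ≤ ‖D.stat σ n (α n) (est n ω) - D.leading σ n (α n) (fun i => ε i ω) - 0‖ := hω
      rw [sub_zero, Real.norm_eq_abs] at hω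
      linarith
    · unfold stat dotProduct
      have := fun l => (measurable_pi_apply l).comp_aemeasurable (hmeas n)
      refine AEMeasurable.const_mul ?_ _
      refine Finset.aemeasurable_fun_sum _ fun l _ => AEMeasurable.const_mul ?_ _
      exact (this l).sub_const _

end SparseArray

theorem CondB1.exists_hasSubgaussianMGF {Ω : Type*} [MeasurableSpace Ω] {μ : Measure Ω}
    [IsProbabilityMeasure μ] {σ : ℝ} {ε : ℕ → Ω → ℝ} (h : CondB1 μ σ ε) :
    ∃ c : NNReal, 0 < c ∧ ∀ i, HasSubgaussianMGF (ε i) c μ := by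
  obtain ⟨-, hident, hL2, hmean, -, -, K, -, C, hC, htail⟩ := h
  obtain ⟨c, hc, hsub⟩ := hasSubgaussianMGF_of_integrable_exp_mul_sq
    (hL2.integrable (by norm_num)) hmean (half_pos hC)
    (integrable_exp_mul_sq_of_tail hL2.aemeasurable hC (htail 0))
  exact ⟨c, hc, fun i => hsub.congr_identDistrib (hident i).symm⟩

theorem theorem4 {Ω : Type*} [MeasurableSpace Ω] (μ : Measure Ω) [IsProbabilityMeasure μ]
    (D : SparseArray) (γ σ : ℝ) (lam lamStar : ℕ → ℝ) (ε : ℕ → Ω → ℝ)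
    (hγ0 : 0 < γ) (hγ1 : γ < 1) (hlam : ∀ n, 0 ≤ lam n) (hlamStar : ∀ n, 0 ≤ lamStar n)
    (hD : D.Standing) (hB1 : CondB1 μ σ ε) (hB2 : D.CondB2) (hB3 : D.CondB3 γ lam)
    (hB4 : D.CondB4) (hB5 : D.CondB5) (hB6 : D.CondB6 lamStar)
    (hlow : D.LowerBound lamStar) :
    -- the two-stage estimator: a bridge fit on the covariates selected by marginal bridge
    (∀ βtilde βhat : ∀ n, Ω → Fin (D.k n) ⊕ Fin (D.m n) → ℝ,
      (∀ n ω, IsMarginalBridge (D.X n) (D.response n (fun i => ε i ω)) γ (lam n) (βtilde n ω)) →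
      (∀ n ω, IsBridgeOn (D.X n) (D.response n (fun i => ε i ω)) γ (lamStar n)
        {j | βtilde n ω j ≠ 0} (βhat n ω)) →
      (∀ n, AEMeasurable (βhat n) μ) →
      D.OracleNormal μ σ ε (fun n ω l => βhat n ω (Sum.inl l))) ∧
    -- the bridge fit on exactly the covariates with nonzero coefficients
    (∀ βhat : ∀ n, Ω → Fin (D.k n) → ℝ,
      (∀ n ω, IsBridgeOn (D.W n) (D.response n (fun i => ε i ω)) γ (lamStar n)
        Set.univ (βhat n ω)) →
      (∀ n, AEMeasurable (βhat n) μ) →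
      D.OracleNormal μ σ ε βhat) := by
  refine ⟨fun βtilde βhat htilde hhat hmeas => ?_, fun βhat hhat hmeas => ?_⟩
  · obtain ⟨c, hc, hsub⟩ := hB1.exists_hasSubgaussianMGF
    have hsel := SparseArray.tendsto_measure_selection_ne hB1.1 hB1.2.1 hB1.2.2.1 hB1.2.2.2.1 hc
      hsub hγ0 hγ1 hlam hD hB2 hB3 hB4 (hB6.tendsto_k_div hlamStar) htilde
    refine SparseArray.oracleNormal_of_tendsto_measure_not_isBridgeOn hB1 hγ0 hγ1 hlamStar hD hB4
      hB5 hB6 hlow ?_ fun n => ?_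
    · refine tendsto_of_tendsto_of_tendsto_of_le_of_le tendsto_const_nhds hsel
        (fun _ => zero_le) fun n => measure_mono fun ω hω heq => hω ?_
      -- With the correct set selected, the second stage is the fit on the relevant covariates, so
      -- failure of the latter forces a selection error.
      exact SparseArray.isBridgeOn_inl hγ0.ne' (heq ▸ hhat n ω)
    · exact aemeasurable_pi_lambda _ fun l =>
        (measurable_pi_apply (Sum.inl l)).comp_aemeasurable (hmeas n)
  · refine SparseArray.oracleNormal_of_tendsto_measure_not_isBridgeOn hB1 hγ0 hγ1 hlamStar hD hB4
      hB5 hB6 hlow ?_ hmeas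
    simp [hhat]
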